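/- Let $S^1=\{z\in\mathbb C:|z|=1\}$ and $T^2=S^1\times S^1$. For an irrational number $\theta$, an integer $d$ and a smooth function $f\colon S^1\to\mathbb R$, the Furstenberg transformation $\phi_{\theta,d,f}\colon T^2\to T^2$ is $$\phi_{\theta,d,f}(x,y)=\left(x\,e^{2\pi i\theta},\; x^{d}\,y\,e^{2\pi i f(x)}\right).$$ Let $M$ be a nonempty smooth manifold (Hausdorff, second countable, without boundary, of any dimension $n\ge 0$). (1) There exist an irrational $\theta$ and a smooth $f\colon S^1\to\mathbb R$ such that, for every integer $d\neq 0$, the maps $\Phi=\mathrm{id}_M\times\phi_{\theta,d,f}$ and $\Phi_0=\mathrm{id}_M\times\phi_{\theta,d,0}$ are smooth diffeomorphisms of $M\times T^2$, there is a homeomorphism $\psi$ of $M\times T^2$ with $\psi\circ\Phi=\Phi_0\circ\psi$, and there is no $C^1$ map $\psi\colon M\times T^2\to M\times T^2$ (in particular no $C^1$-diffeomorphism) with $\psi\circ\Phi=\Phi_0\circ\psi$. (2) Suppose that $M$ carries a volume form $\mu$, and equip $M\times T^2$ with the product volume form $\Omega=\mu\wedge dx\wedge dy$, where $dx$ and $dy$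 denote the forms on the two circle factors that are $dt$ in the coordinate $t\mapsto e^{2\pi i t}$. Then $\theta$ and $f$ can be chosen such that, for every integer $d\neq0$, all the conclusions of (1) hold and in addition $\Phi^*\Omega=\Omega$, $\Phi_0^*\Omega=\Omega$, and the homeomorphism $\psi$ with $\psi\circ\Phi=\Phi_0\circ\psi$ can be chosen to preserve the measure on $M\times T^2$ induced by $\Omega$. -/

import Mathlib

open scoped Manifold ContDiff
open MeasureTheory

noncomputable section

/-- The circle `S¹ = {z ∈ ℂ : |z| = 1}` carries its Borel sigma-algebra. -/
instance Circle.borelMeasurableSpace : MeasurableSpace Circle := borel Circle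

instance Circle.isBorelSpace : BorelSpace Circle := ⟨rfl⟩

/-- The two-torus `T² = S¹ × S¹`. -/
abbrev Torus : Type := Circle × Circle

/-- The model space of `T²`. -/
abbrev TorusModel : Type := EuclideanSpace ℝ (Fin 1) × EuclideanSpace ℝ (Fin 1)

/-- The Furstenberg map `(x, y) ↦ (x e^{2πiθ}, x^d y e^{2πi f(x)})` of `T²`. -/
def furstenberg (θ : ℝ) (d : ℤ) (f : Circle → ℝ) (q : Torus) : Torus :=
  (q.1 * Circle.exp (2 * Real.pi * θ), q.1 ^ d * q.2 * Circle.exp (2 * Real.pi * f q.1))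

section Forms

variable {E : Type*} [NormedAddCommGroup E] [NormedSpace ℝ E]
  {H : Type*} [TopologicalSpace H] (I : ModelWithCorners ℝ E H)
  {F : Type*} [NormedAddCommGroup F] [NormedSpace ℝ F]
  {G : Type*} [TopologicalSpace G] (J : ModelWithCorners ℝ F G)

/-- A (not necessarily smooth) differential form on `M`: an alternating multilinear form, with
arguments indexed by `ι`, on each tangent space. Its degree is the cardinality of `ι`. -/
abbrev FormField (M : Type*) [TopologicalSpace M] [ChartedSpace H M] (ι : Type*) :=
  ∀ p : M, (TangentSpace I p) [⋀^ι]→ₗ[ℝ] ℝ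

variable {M : Type*} [TopologicalSpace M] [ChartedSpace H M]
  {N : Type*} [TopologicalSpace N] [ChartedSpace G N]
  {ι κ : Type*}

/-- The pullback `φ^* α` of a form on `N` along `φ : M → N`. -/
def pullbackForm (φ : M → N) (α : FormField J N ι) : FormField I M ι :=
  fun p => (α (φ p)).compLinearMap (mfderiv I J φ p).toLinearMap

/-- The wedge product `α ∧ η` of two forms on `M`. -/
def wedgeForm [Fintype ι] [DecidableEq ι] [Fintype κ] [DecidableEq κ]
    (α : FormField I M ι) (η : FormField I M κ) : FormField I M (ι ⊕ κ) :=
  fun p => (LinearMap.mul' ℝ ℝ).compAlternatingMap ((α p).domCoprod (η p))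

/-- The exterior product `pr₁^* α ∧ pr₂^* η` on `M × N`. -/
def prodForm [Fintype ι] [DecidableEq ι] [Fintype κ] [DecidableEq κ]
    (α : FormField I M ι) (η : FormField J N κ) : FormField (I.prod J) (M × N) (ι ⊕ κ) :=
  wedgeForm (I.prod J) (pullbackForm (I.prod J) I Prod.fst α)
    (pullbackForm (I.prod J) J Prod.snd η)

/-- The form `α` in the local coordinates around `x`: the pullback of `α` along the inverse of the
chart. It is meaningful on the open set `(extChartAt I x).target`, and is meant for manifolds
without boundary. -/
def localForm (α : FormField I M ι) (x : M) (u : E) : E [⋀^ι]→ₗ[ℝ] ℝ :=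
  pullbackForm 𝓘(ℝ, E) I (extChartAt I x).symm α u

/-- `α` is a volume form on the (boundaryless) manifold `M`: a form of top degree, with smooth
coefficients in local coordinates, that vanishes nowhere. -/
structure IsVolumeForm [Fintype ι] (α : FormField I M ι) : Prop where
  top_degree : Fintype.card ι = Module.finrank ℝ E
  smooth : ∀ (x : M) (v : ι → E),
    ContDiffOn ℝ ∞ (fun u => localForm I α x u v) (extChartAt I x).target
  ne_zero : ∀ p : M, α p ≠ 0

variable [MeasurableSpace E] [BorelSpace E] [MeasurableSpace M]

/-- The measure induced by a form `α` of top degree inside the chart around `x`: the image under the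
inverse of the chart of the measure `|α(b₁, …, bₙ)| dλ_b` on the target of the chart, where `λ_b` is
the Lebesgue measure normalized by the basis `b` (the parallelepiped spanned by `b` has measure
`1`). It does not depend on the choice of `b`, and gives no mass to the complement of the
domain of the chart. -/
def chartMeasure [Fintype ι] (b : Module.Basis ι ℝ E) (α : FormField I M ι) (x : M) : Measure M :=
  ((b.addHaar.restrict (extChartAt I x).target).withDensity
    (fun u => ENNReal.ofReal |localForm I α x u b|)).map (extChartAt I x).symm

/-- The measure on `M` induced by a volume form `α`. On the domain of each chart it is the measure
`chartMeasure`; as `M` is second countable, it is therefore the smallest measure that dominates all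
the chart measures. -/
def volumeMeasure [Fintype ι] (b : Module.Basis ι ℝ E) (α : FormField I M ι) : Measure M :=
  ⨆ x : M, chartMeasure I b α x

end Forms

/-- The invariant form `dx` on the circle, `x = e^{2πit} ↦ dt`, i.e. `dx = (2πi)⁻¹ z̄ dz`. -/
def circleForm : FormField (𝓡 1) Circle (Fin 1) := fun z =>
  AlternatingMap.ofSubsingleton ℝ (TangentSpace (𝓡 1) z) ℝ (0 : Fin 1)
    ((2 * Real.pi)⁻¹ • (Complex.imLm ∘ₗ LinearMap.mulLeft ℝ (star (z : ℂ)) ∘ₗ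
      (mfderiv (𝓡 1) 𝓘(ℝ, ℂ) (fun w : Circle => (w : ℂ)) z).toLinearMap))

/-- The standard area form `dx ∧ dy` on `T²`. -/
def torusForm : FormField ((𝓡 1).prod (𝓡 1)) Torus (Fin 1 ⊕ Fin 1) :=
  prodForm (𝓡 1) (𝓡 1) circleForm circleForm

/-- The standard basis of the model space `ℝⁿ × (ℝ × ℝ)` of `M × T²`. -/
def stdBasis (n : ℕ) :
    Module.Basis (Fin n ⊕ (Fin 1 ⊕ Fin 1)) ℝ (EuclideanSpace ℝ (Fin n) × TorusModel) :=
  (EuclideanSpace.basisFun (Fin n) ℝ).toBasis.prod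
    ((EuclideanSpace.basisFun (Fin 1) ℝ).toBasis.prod (EuclideanSpace.basisFun (Fin 1) ℝ).toBasis)

/-- The smooth structure of `M × T²`, where `M` has dimension `n`. -/
abbrev bundleModel (n : ℕ) :=
  (𝓡 n).prod ((𝓡 1).prod (𝓡 1))

/-- The product volume form `μ ∧ dx ∧ dy` on `M × T²`. -/
def bundleForm {n : ℕ} {M : Type*} [TopologicalSpace M] [ChartedSpace (EuclideanSpace ℝ (Fin n)) M]
    (μ : FormField (𝓡 n) M (Fin n)) :
    FormField (bundleModel n) (M × Torus) (Fin n ⊕ (Fin 1 ⊕ Fin 1)) :=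
  prodForm (𝓡 n) ((𝓡 1).prod (𝓡 1)) μ torusForm

end

/-! ### A smooth coboundary over a Liouville rotation with a non-Lipschitz transfer function. -/

section Series
open Real Filter

/-! If f = g - g ∘ R_θ with g continuous, the fibre rotation (m, x, y) ↦ (m, x, y e^{2πi g(x)})
conjugates Φ to Φ₀ (`fiberRotation_semiconj`). What is needed is a smooth f whose transfer function
g is so rough that no C¹ semiconjugacy exists. For a Liouville θ with very good denominators q_k,
the series G(s) = ∑ 2^{-k} cos(2π q_k s) is continuous, even and not Lipschitz at 0, while F = G -
G(· + θ) is smooth, because its k-th term carries the tiny factor sin(π q_k θ)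
(`exists_smooth_coboundary_of_not_lipschitz`).

For the obstruction, restrict a C¹ semiconjugacy to one torus {m} × T² and lift to ℝ². Its torus
components A, B are unimodular and satisfy A ∘ φ = e^{2πiθ} A and B ∘ φ = A^d B. The N-th iterate of
φ shears the second coordinate with slope Nd + D, where D is the derivative of G - G(· + Nθ).
Differentiating the iterated equations in s gives bounds independent of N (`norm_twisted_le`). Since
|F'| ≤ 1/2 and d ≠ 0, the slope is at least N/2 in absolute value. This forces ∂_t A = 0 and hence A
= const · e^{2πis} (`eq_exp_of_eigenfunction`). The same bounds for B force ∂_t B / B = 2πi, after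
which they say that D is bounded uniformly in N. By density G - G(· + τ) is then Lipschitz with one
constant for all τ, which contradicts the choice of G (`not_semiconj_rotation_of_not_lipschitz`).

For volumes, φ^*(dx ∧ dy) = dx ∧ dy since dy changes only by a form pulled back from the first
circle. The measure of Ω is a supremum of chart measures, each a product whose circle factors are
the Haar measure, so a rotation of the last circle depending continuously on x preserves it. Neither
θ nor f depends on M or μ, so one choice serves both parts. -/

theorem iteratedDeriv_mul_sin_affine (c a b : ℝ) (n : ℕ) :
    iteratedDeriv n (fun s => c * sin (a * s + b)) =
      fun s => c * a ^ n * sin (a * s + b + n * (π / 2)) := by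
  induction n with
  | zero => simp
  | succ n ih =>
    rw [iteratedDeriv_succ, ih]
    funext s
    have h : HasDerivAt (fun s => c * a ^ n * sin (a * s + b + n * (π / 2)))
        (c * a ^ n * (cos (a * s + b + n * (π / 2)) * (a * 1))) s :=
      (((((hasDerivAt_id s).const_mul a).add_const b).add_const _).sin).const_mul _
    rw [h.deriv]
    have : a * s + b + ((n + 1 : ℕ) : ℝ) * (π / 2) = a * s + b + n * (π / 2) + π / 2 := by
      push_cast; ring
    rw [this, sin_add_pi_div_two]
    ring

theorem norm_iteratedFDeriv_mul_sin_affine_le (c a b : ℝ) (n : ℕ) (s : ℝ) :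
    ‖iteratedFDeriv ℝ n (fun s => c * sin (a * s + b)) s‖ ≤ |c| * |a| ^ n := by
  rw [norm_iteratedFDeriv_eq_norm_iteratedDeriv, iteratedDeriv_mul_sin_affine, norm_eq_abs,
    abs_mul, abs_mul, abs_pow]
  exact mul_le_of_le_one_right (by positivity) (abs_sin_le_one _)

theorem abs_sin_pi_mul_le (x : ℝ) (p : ℤ) : |sin (π * x)| ≤ π * |x - p| := by
  have h : |sin (π * x)| = |sin (π * (x - p))| := by
    rw [mul_sub, mul_comm π (p : ℝ), sin_sub_int_mul_pi, abs_mul]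
    rcases Int.even_or_odd p with hp | hp
    · simp [hp.neg_one_zpow]
    · simp [hp.neg_one_zpow]
  rw [h]
  refine abs_sin_le_abs.trans ?_
  rw [abs_mul, abs_of_pos pi_pos]

/-- A smooth function with small derivative which is the coboundary, over an irrational rotation,
of a continuous function which is not Lipschitz. -/
theorem exists_smooth_coboundary_of_not_lipschitz :
    ∃ (θ : ℝ) (F G : ℝ → ℝ), Irrational θ ∧ ContDiff ℝ ∞ F ∧ Continuous G ∧
      Function.Periodic G 1 ∧ (∀ s, F s = G s - G (s + θ)) ∧ (∀ s, |deriv F s| ≤ 1 / 2) ∧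
      (∀ s, G (-s) = G s) ∧ ∀ C : ℝ, ∃ h > 0, C * h < |G 0 - G h| := by
  have hL := liouville_liouvilleNumber (m := 2) le_rfl
  set θ := liouvilleNumber (2 : ℕ) with hθ
  -- The j-th derivative of the k-th term of F will cost q^(2+2j). The exponent 2k+5 absorbs this
  -- for j ≤ k, and for j = 1 it leaves a spare factor q ≥ 8 even when k = 0. The bound q ≥ 8 also
  -- gives 2πq ≤ q², and q ≥ 4^k serves the failure of the Lipschitz condition.
  have hq : ∀ k : ℕ, ∃ q : ℕ, (4 ^ k ≤ q ∧ 8 ≤ q) ∧ ∃ p : ℤ, θ ≠ p / q ∧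
      |θ - p / q| < 1 / (q : ℝ) ^ (2 * k + 5) := fun k =>
    ((((eventually_ge_atTop (4 ^ k)).and (eventually_ge_atTop 8)).and_frequently
      (hL.frequently_exists_num (2 * k + 5))).exists)
  choose q hq8 p _ hp using hq
  have hq4 : ∀ k, (4 : ℝ) ^ k ≤ q k := fun k => by exact_mod_cast (hq8 k).1
  have hq8 : ∀ k, (8 : ℝ) ≤ q k := fun k => by exact_mod_cast (hq8 k).2
  have hq0 : ∀ k, (0 : ℝ) < q k := fun k => by linarith [hq8 k]
  let g : ℕ → ℝ → ℝ := fun k s => (1 / 2) ^ k * cos (2 * π * q k * s)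
  let f : ℕ → ℝ → ℝ := fun k s =>
    (1 / 2) ^ k * (2 * sin (π * (q k * θ))) * sin (2 * π * q k * s + π * (q k * θ))
  have hfg : ∀ k s, f k s = g k s - g k (s + θ) := by
    intro k s
    simp only [f, g]
    rw [← mul_sub, cos_sub_cos]
    have h1 : (2 * π * q k * s + 2 * π * q k * (s + θ)) / 2 =
      2 * π * q k * s + π * (q k * θ) := by ring
    have h2 : (2 * π * q k * s - 2 * π * q k * (s + θ)) / 2 = - (π * (q k * θ)) := by ring
    rw [h1, h2, sin_neg]
    ring
  have hbase : Summable fun k : ℕ => ((1 : ℝ) / 2) ^ k :=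
    summable_geometric_of_lt_one (by norm_num) (by norm_num)
  have hgle : ∀ k s, ‖g k s‖ ≤ (1 / 2) ^ k := by
    intro k s
    simp only [g, norm_mul, norm_pow, norm_eq_abs]
    rw [abs_of_pos (by norm_num : (0 : ℝ) < 1 / 2)]
    exact mul_le_of_le_one_right (by positivity) (abs_cos_le_one _)
  have hgs : ∀ s, Summable fun k => g k s := fun s =>
    Summable.of_norm_bounded hbase (hgle · s)
  have hfs : ∀ s, Summable fun k => f k s := fun s => by
    simp only [hfg]; exact (hgs s).sub (hgs _)
  have hfc : ∀ k, ContDiff ℝ ∞ (f k) := fun k =>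
    contDiff_const.mul (contDiff_sin.comp ((contDiff_const.mul contDiff_id).add contDiff_const))
  have hsin : ∀ k, |sin (π * (q k * θ))| ≤ π * q k / (q k) ^ (2 * k + 5) := by
    intro k
    refine (abs_sin_pi_mul_le _ (p k)).trans ?_
    have : q k * θ - p k = q k * (θ - p k / q k) := by
      have := (hq0 k).ne'
      field_simp
    rw [this, abs_mul, abs_of_pos (hq0 k), mul_div_assoc]
    have h := (hp k).le
    rw [div_eq_mul_one_div (q k : ℝ)]
    gcongr
  have hbd : ∀ j k s, ‖iteratedFDeriv ℝ j (f k) s‖ ≤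
      (1 / 2) ^ k * ((q k : ℝ) ^ (2 + 2 * j) / (q k) ^ (2 * k + 5)) := by
    intro j k s
    refine (norm_iteratedFDeriv_mul_sin_affine_le _ _ _ _ _).trans ?_
    rw [abs_mul, abs_mul, abs_of_nonneg (by positivity : (0 : ℝ) ≤ (1 / 2) ^ k), mul_assoc]
    have hqq : 2 * π * q k ≤ (q k) ^ 2 := by
      have := pi_lt_four
      nlinarith [hq8 k]
    have h2 : |(2 * π * q k : ℝ)| = 2 * π * q k := abs_of_pos (by have := hq0 k; positivity)
    rw [h2, abs_two]
    refine mul_le_mul_of_nonneg_left ?_ (by positivity)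
    have hqp := hq0 k
    calc 2 * |sin (π * (q k * θ))| * (2 * π * q k) ^ j
        ≤ 2 * (π * q k / (q k) ^ (2 * k + 5)) * (((q k : ℝ) ^ 2)) ^ j := by
          gcongr
          exact hsin k
      _ = (2 * π * q k) * (((q k : ℝ) ^ 2)) ^ j / (q k) ^ (2 * k + 5) := by ring
      _ ≤ (q k) ^ 2 * (((q k : ℝ) ^ 2)) ^ j / (q k) ^ (2 * k + 5) := by gcongr
      _ = _ := by rw [← pow_mul, ← pow_add]
  have hbd' : ∀ j k s, j ≤ k → ‖iteratedFDeriv ℝ j (f k) s‖ ≤ (1 / 2) ^ k := by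
    intro j k s hjk
    refine (hbd j k s).trans (mul_le_of_le_one_right (by positivity) ?_)
    have hqp := hq0 k
    rw [div_le_one (by positivity)]
    exact pow_le_pow_right₀ (by linarith [hq8 k]) (by omega)
  have hbd1 : ∀ k s, ‖deriv (f k) s‖ ≤ (1 / 2) ^ k * (1 / 8) := by
    intro k s
    have h := hbd 1 k s
    rw [norm_iteratedFDeriv_eq_norm_iteratedDeriv, iteratedDeriv_one] at h
    refine h.trans (mul_le_mul_of_nonneg_left ?_ (by positivity))
    have hqp := hq0 k
    rw [div_le_div_iff₀ (by positivity) (by norm_num), one_mul]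
    calc (q k : ℝ) ^ (2 + 2 * 1) * 8 ≤ (q k : ℝ) ^ (2 + 2 * 1) * q k := by gcongr; exact hq8 k
      _ = (q k : ℝ) ^ 5 := by ring
      _ ≤ _ := pow_le_pow_right₀ (by linarith [hq8 k]) (by omega)
  refine ⟨θ, fun s => ∑' k, f k s, fun s => ∑' k, g k s, hL.irrational, ?_, ?_, ?_, ?_, ?_, ?_, ?_⟩
  -- For each order j only the finitely many terms with k < j escape the geometric bound.
  · refine contDiff_tsum_of_eventually (v := fun _ k => (1 / 2) ^ k) hfc (fun _ _ => hbase) ?_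
    intro j _
    rw [Nat.cofinite_eq_atTop]
    filter_upwards [eventually_ge_atTop j] with k hk s using hbd' j k s hk
  · exact continuous_tsum (fun k => by simp only [g]; fun_prop) hbase hgle
  · intro s
    refine tsum_congr fun k => ?_
    simp only [g]
    rw [show 2 * π * q k * (s + 1) = 2 * π * q k * s + q k * (2 * π) by ring,
      cos_add_nat_mul_two_pi]
  · intro s
    simp only [hfg]
    exact (hgs s).tsum_sub (hgs _)
  · intro s
    have hd : ∀ k s, DifferentiableAt ℝ (f k) s := fun k s =>
      ((hfc k).differentiable (by simp)) s
    rw [deriv_tsum_apply (hbase.mul_right (1 / 8)) hd hbd1 (hfs 0) s]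
    refine (norm_eq_abs _).symm.le.trans ?_
    refine (tsum_of_norm_bounded (hbase.mul_right (1 / 8)).hasSum (hbd1 · s)).trans ?_
    rw [tsum_mul_right, tsum_geometric_of_lt_one (by norm_num) (by norm_num)]
    norm_num
  · intro s
    refine tsum_congr fun k => ?_
    simp only [g]
    rw [mul_neg, cos_neg]
  · intro C
    obtain ⟨k, hk⟩ := pow_unbounded_of_one_lt C (one_lt_two)
    have hqp := hq0 k
    -- Half a period of the k-th cosine: that term drops by 2 · 2^{-k}, and no other term increases,
    -- as every cosine is maximal at 0. Since q_k ≥ 4^k and C < 2^k, the drop exceeds C h.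
    refine ⟨1 / (2 * q k), by positivity, ?_⟩
    have h1 : 2 * (1 / 2) ^ k ≤ (∑' k, g k 0) - ∑' j, g j (1 / (2 * q k)) := by
      rw [← (hgs 0).tsum_sub (hgs _)]
      have : g k 0 - g k (1 / (2 * q k)) = 2 * (1 / 2) ^ k := by
        simp only [g]
        rw [show 2 * π * q k * (1 / (2 * q k)) = π by field_simp, cos_pi]
        simp
        ring
      rw [← this]
      refine ((hgs 0).sub (hgs _)).le_tsum k fun j _ => ?_
      simp only [g]
      rw [← mul_sub]
      refine mul_nonneg (by positivity) ?_
      simp [cos_le_one]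
    refine lt_of_lt_of_le ?_ (h1.trans (le_abs_self _))
    have h4 : (2 : ℝ) ^ k * 2 ^ k ≤ q k := by
      rw [← mul_pow]; norm_num; exact hq4 k
    have h2 : (0 : ℝ) < 2 ^ k := by positivity
    rw [one_div_pow, mul_one_div, mul_one_div, div_lt_div_iff₀ (by positivity) h2]
    nlinarith

end Series

/-! ### Rigidity of C¹ solutions of the twisted equations on the plane. -/

section CohomologicalEquation
open Real Filter

/-- The periods contain ℤθ + ℤ, which is dense. -/
theorem Function.Periodic.eq_of_irrational {X : Type*} [TopologicalSpace X] [T2Space X]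
    {u : ℝ → X} (hu : Continuous u) {θ : ℝ} (hθ : Irrational θ) (h1 : Function.Periodic u 1)
    (h2 : Function.Periodic u θ) (s : ℝ) : u s = u 0 := by
  have hd : Dense (AddSubgroup.closure {θ, 1} : Set ℝ) :=
    dense_addSubgroupClosure_pair_iff.2 (by simpa using hθ)
  refine congrFun (hu.ext_on hd (continuous_const (y := u 0)) ?_) s
  intro x hx
  obtain ⟨m, n, rfl⟩ := AddSubgroup.mem_closure_pair.1 hx
  have := (h1.zsmul n) (m • θ)
  rw [this]
  simpa using (h2.zsmul m) 0

/-- Biperiodic functions on the plane. -/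
def Biperiodic {X : Type*} (U : ℝ × ℝ → X) : Prop :=
  (∀ s t, U (s + 1, t) = U (s, t)) ∧ ∀ s t, U (s, t + 1) = U (s, t)

theorem Biperiodic.exists_norm_le {U : ℝ × ℝ → ℂ} (hU : Biperiodic U) (hc : Continuous U) :
    ∃ C, ∀ s t, ‖U (s, t)‖ ≤ C := by
  obtain ⟨C, hC⟩ := ((isCompact_Icc (a := (0 : ℝ)) (b := 1)).prod
    (isCompact_Icc (a := (0 : ℝ)) (b := 1))).exists_bound_of_continuousOn hc.continuousOn
  refine ⟨C, fun s t => ?_⟩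
  have h1 : Function.Periodic (fun s => U (s, t)) 1 := fun s => hU.1 s t
  have h2 : Function.Periodic (fun t => U (Int.fract s, t)) 1 := fun t => hU.2 _ t
  have e1 : U (Int.fract s, t) = U (s, t) := by
    simpa only [mul_one, Int.self_sub_floor] using h1.sub_int_mul_eq ⌊s⌋ (x := s)
  have e2 : U (Int.fract s, Int.fract t) = U (Int.fract s, t) := by
    simpa only [mul_one, Int.self_sub_floor] using h2.sub_int_mul_eq ⌊t⌋ (x := t)
  rw [← e1, ← e2]
  exact hC _ ⟨⟨Int.fract_nonneg _, (Int.fract_lt_one _).le⟩,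
    ⟨Int.fract_nonneg _, (Int.fract_lt_one _).le⟩⟩

theorem Biperiodic.fderiv_apply {U : ℝ × ℝ → ℂ} (hU : Biperiodic U) (v : ℝ × ℝ) :
    Biperiodic fun p => fderiv ℝ U p v := by
  constructor <;> intro s t
  · have : (fun p : ℝ × ℝ => U (p + (1, 0))) = U := by
      funext ⟨s, t⟩
      simpa using hU.1 s t
    have h := fderiv_comp_add_right (𝕜 := ℝ) (f := U) (x := (s, t)) ((1, 0) : ℝ × ℝ)
    rw [this] at h
    simp [h]
  · have : (fun p : ℝ × ℝ => U (p + (0, 1))) = U := by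
      funext ⟨s, t⟩
      simpa using hU.2 s t
    have h := fderiv_comp_add_right (𝕜 := ℝ) (f := U) (x := (s, t)) ((0, 1) : ℝ × ℝ)
    rw [this] at h
    simp [h]

theorem hasDerivAt_left {U : ℝ × ℝ → ℂ} (hU : Differentiable ℝ U) (s t : ℝ) :
    HasDerivAt (fun s => U (s, t)) (fderiv ℝ U (s, t) (1, 0)) s :=
  (hU (s, t)).hasFDerivAt.comp_hasDerivAt s ((hasDerivAt_id s).prodMk (hasDerivAt_const s t))

theorem hasDerivAt_right {U : ℝ × ℝ → ℂ} (hU : Differentiable ℝ U) (s t : ℝ) :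
    HasDerivAt (fun t => U (s, t)) (fderiv ℝ U (s, t) (0, 1)) t :=
  (hU (s, t)).hasFDerivAt.comp_hasDerivAt t ((hasDerivAt_const t s).prodMk (hasDerivAt_id t))

section Twisted

variable {U : ℝ × ℝ → ℂ} {σ : ℝ} {P : ℝ → ℝ} {K : ℝ → ℂ}

theorem fderiv_right_of_twisted (hU : Differentiable ℝ U)
    (h : ∀ s t, U (s + σ, t + P s) = K s * U (s, t)) (s t : ℝ) :
    fderiv ℝ U (s + σ, t + P s) (0, 1) = K s * fderiv ℝ U (s, t) (0, 1) := by
  have h1 := (hasDerivAt_right hU (s + σ) (t + P s)).comp_add_const t (P s)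
  simp only [h] at h1
  exact h1.unique ((hasDerivAt_right hU s t).const_mul _)

theorem fderiv_left_of_twisted (hU : Differentiable ℝ U)
    (h : ∀ s t, U (s + σ, t + P s) = K s * U (s, t)) {s P' : ℝ} {K' : ℂ}
    (hP : HasDerivAt P P' s) (hK : HasDerivAt K K' s) (t : ℝ) :
    fderiv ℝ U (s + σ, t + P s) (1, 0) + P' * fderiv ℝ U (s + σ, t + P s) (0, 1) =
      K' * U (s, t) + K s * fderiv ℝ U (s, t) (1, 0) := by
  have h1 : HasDerivAt (fun s => U (s + σ, t + P s))
      (fderiv ℝ U (s + σ, t + P s) (1, P')) s :=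
    (hU (s + σ, t + P s)).hasFDerivAt.comp_hasDerivAt s
      (((hasDerivAt_id s).add_const σ).prodMk (hP.const_add t))
  simp only [h] at h1
  have h2 := h1.unique (hK.mul (hasDerivAt_left hU s t))
  rw [← h2]
  have : ((1, P') : ℝ × ℝ) = (1, 0) + P' • ((0, 1) : ℝ × ℝ) := by simp
  rw [this, map_add, map_smul]
  simp

/-- Differentiating the twisted equation in s writes the left side, up to a unimodular factor, as a
difference of two values of ∂_s U with unimodular coefficients. The bound involves neither P' nor m,
so it can be applied to iterates, where both may grow linearly. -/
theorem norm_twisted_le (hU : Differentiable ℝ U)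
    (h : ∀ s t, U (s + σ, t + P s) = K s * U (s, t)) {s P' : ℝ} {m C : ℝ}
    (hP : HasDerivAt P P' s) (hK : HasDerivAt K (2 * π * Complex.I * m * K s) s)
    (hK1 : ‖K s‖ = 1) (hC : ∀ s t, ‖fderiv ℝ U (s, t) (1, 0)‖ ≤ C) (t : ℝ) :
    ‖P' * fderiv ℝ U (s, t) (0, 1) - 2 * π * Complex.I * m * U (s, t)‖ ≤ 2 * C := by
  have h1 := fderiv_left_of_twisted hU h hP hK t
  rw [fderiv_right_of_twisted hU h] at h1
  have h2 : K s * (P' * fderiv ℝ U (s, t) (0, 1) - 2 * π * Complex.I * m * U (s, t)) =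
      K s * fderiv ℝ U (s, t) (1, 0) - fderiv ℝ U (s + σ, t + P s) (1, 0) := by
    linear_combination h1
  have h3 := congrArg norm h2
  rw [norm_mul, hK1, one_mul] at h3
  rw [h3]
  refine (norm_sub_le _ _).trans ?_
  rw [norm_mul, hK1, one_mul, two_mul]
  exact add_le_add (hC _ _) (hC _ _)

end Twisted

/-- The shift of the second coordinate in the `N`-th iterate of the lift
`(s, t) ↦ (s + θ, t + d s + F s)` of a Furstenberg map, where `F = G - G (· + θ)`. -/
noncomputable def iterateShift (θ : ℝ) (d : ℤ) (G : ℝ → ℝ) (N : ℕ) (s : ℝ) : ℝ :=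
  N * d * s + d * θ * (N * (N - 1) / 2) + (G s - G (s + N * θ))

theorem iterateShift_succ {θ : ℝ} {d : ℤ} {F G : ℝ → ℝ} (hFG : ∀ s, F s = G s - G (s + θ))
    (N : ℕ) (s : ℝ) : iterateShift θ d G (N + 1) s =
      iterateShift θ d G N s + (d * (s + N * θ) + F (s + N * θ)) := by
  simp only [iterateShift, hFG]
  push_cast
  rw [show s + (N + 1) * θ = s + N * θ + θ by ring]
  ring

/-- G need not be differentiable, but the difference telescopes into a sum of N translates of F,
each of slope at most 1/2. Hence D cannot cancel the shear Nd. -/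
theorem exists_hasDerivAt_coboundary {θ : ℝ} {F G : ℝ → ℝ} (hF : Differentiable ℝ F)
    (hF1 : ∀ s, |deriv F s| ≤ 1 / 2)
    (hFG : ∀ s, F s = G s - G (s + θ)) (N : ℕ) (s : ℝ) :
    ∃ D, HasDerivAt (fun s => G s - G (s + N * θ)) D s ∧ |D| ≤ N / 2 := by
  induction N with
  | zero => exact ⟨0, by simpa using hasDerivAt_const s (0 : ℝ), by simp⟩
  | succ N ih =>
    obtain ⟨D, hD, hDN⟩ := ih
    refine ⟨D + deriv F (s + N * θ), ?_, ?_⟩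
    · have h := hD.add ((hF (s + N * θ)).hasDerivAt.comp_add_const s (N * θ))
      refine h.congr_of_eventuallyEq (Eventually.of_forall fun x => ?_)
      simp only [Pi.add_apply, hFG]
      push_cast
      rw [show x + (N + 1) * θ = x + N * θ + θ by ring]
      ring
    · refine (abs_add_le _ _).trans ?_
      push_cast
      linarith [hF1 (s + N * θ)]

theorem hasDerivAt_iterateShift {θ : ℝ} {d : ℤ} {G : ℝ → ℝ} {N : ℕ} {s D : ℝ}
    (h : HasDerivAt (fun s => G s - G (s + N * θ)) D s) :
    HasDerivAt (iterateShift θ d G N) (N * d + D) s := by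
  have := (((hasDerivAt_id s).const_mul ((N : ℝ) * d)).add_const
    (d * θ * (N * (N - 1) / 2))).add h
  rw [mul_one] at this
  exact this

theorem twisted_iterate {θ : ℝ} {d : ℤ} {F G : ℝ → ℝ} (hFG : ∀ s, F s = G s - G (s + θ))
    {U : ℝ × ℝ → ℂ} {κ : ℝ → ℂ}
    (h : ∀ s t, U (s + θ, t + (d * s + F s)) = κ s * U (s, t)) (N : ℕ) (s t : ℝ) :
    U (s + N * θ, t + iterateShift θ d G N s) =
      (∏ k ∈ Finset.range N, κ (s + k * θ)) * U (s, t) := by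
  induction N with
  | zero => simp [iterateShift]
  | succ N ih =>
    rw [iterateShift_succ hFG, Finset.prod_range_succ, mul_comm _ (κ _), mul_assoc, ← ih, ← h]
    push_cast
    ring_nf

/-- The exponent is `iterateShift` without its G terms, so the multiplier has logarithmic derivative
2πi N d while the shift has slope N d + D. -/
theorem prod_exp_affine {θ : ℝ} (d : ℤ) (c : ℂ) (N : ℕ) (s : ℝ) :
    ∏ k ∈ Finset.range N, (c * Complex.exp (2 * π * Complex.I * (d * (s + k * θ) : ℝ))) =
      c ^ N * Complex.exp (2 * π * Complex.I *
        ((N * d * s + d * θ * (N * (N - 1) / 2) : ℝ) : ℂ)) := by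
  induction N with
  | zero => simp
  | succ N ih =>
    rw [Finset.prod_range_succ, ih, pow_succ, mul_mul_mul_comm, ← Complex.exp_add]
    congr 2
    push_cast
    ring

theorem norm_exp_two_pi_I (x : ℝ) : ‖Complex.exp (2 * π * Complex.I * x)‖ = 1 := by
  have : (2 * π * Complex.I * x : ℂ) = ((2 * π * x : ℝ) : ℂ) * Complex.I := by push_cast; ring
  rw [this, Complex.norm_exp_ofReal_mul_I]

/-- For fixed s and s' the condition on τ is closed, and it holds on the dense group ℤθ + ℤ. -/
theorem lipschitz_of_coboundary_lipschitz {θ C : ℝ} {G : ℝ → ℝ} (hθ : Irrational θ)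
    (hG : Continuous G) (hG1 : Function.Periodic G 1)
    (h : ∀ (N : ℕ) (s s' : ℝ), |(G s - G (s + N * θ)) - (G s' - G (s' + N * θ))| ≤ C * |s - s'|)
    (τ s s' : ℝ) : |(G s - G (s + τ)) - (G s' - G (s' + τ))| ≤ C * |s - s'| := by
  have hd : Dense (AddSubgroup.closure {θ, 1} : Set ℝ) :=
    dense_addSubgroupClosure_pair_iff.2 (by simpa using hθ)
  have hcl : IsClosed {τ : ℝ | |(G s - G (s + τ)) - (G s' - G (s' + τ))| ≤ C * |s - s'|} :=
    isClosed_le (by fun_prop) continuous_const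
  refine (closure_minimal (s := (AddSubgroup.closure {θ, 1} : Set ℝ)) ?_ hcl) (hd τ)
  intro x hx
  obtain ⟨m, n, rfl⟩ := AddSubgroup.mem_closure_pair.1 hx
  have hp : ∀ y, G (y + (m • θ + n • 1)) = G (y + m * θ) := fun y => by
    have := (hG1.zsmul n) (y + m • θ)
    rw [← add_assoc, this, zsmul_eq_mul]
  simp only [Set.mem_ofPred_eq, hp]
  obtain ⟨N, rfl | rfl⟩ := m.eq_nat_or_neg
  · simpa using h N s s'
  -- A negative multiple reduces to a positive one by translating both points back by Nθ.
  · have h1 := h N (s - N * θ) (s' - N * θ)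
    rw [sub_add_cancel, sub_add_cancel, sub_sub_sub_cancel_right] at h1
    rw [abs_sub_comm] at h1
    push_cast
    rw [neg_mul, ← sub_eq_add_neg, ← sub_eq_add_neg]
    convert h1 using 2
    ring

variable {θ : ℝ} {d : ℤ} {F G : ℝ → ℝ}

/-- A unimodular `C¹` eigenfunction of the lift of a Furstenberg map, with the eigenvalue of the
rotation of the base, is a multiple of the first coordinate. -/
theorem eq_exp_of_eigenfunction (hθ : Irrational θ) (hd : d ≠ 0) (hF : Differentiable ℝ F)
    (hFG : ∀ s, F s = G s - G (s + θ)) (hF1 : ∀ s, |deriv F s| ≤ 1 / 2)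
    {A : ℝ × ℝ → ℂ} (hA : ContDiff ℝ 1 A) (hAp : Biperiodic A)
    (h : ∀ s t, A (s + θ, t + (d * s + F s)) =
      Complex.exp (2 * π * Complex.I * θ) * A (s, t)) (s t : ℝ) :
    A (s, t) = A (0, 0) * Complex.exp (2 * π * Complex.I * s) := by
  have hAd : Differentiable ℝ A := hA.differentiable (by simp)
  have hfc : ∀ v, Continuous fun p => fderiv ℝ A p v := fun v =>
    (hA.continuous_fderiv (by simp)).clm_apply continuous_const
  obtain ⟨C, hC⟩ := (hAp.fderiv_apply (1, 0)).exists_norm_le (hfc _)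
  have hder : ∀ s t, fderiv ℝ A (s, t) (0, 1) = 0 := by
    intro s t
    by_contra hne
    have hpos : 0 < ‖fderiv ℝ A (s, t) (0, 1)‖ := norm_pos_iff.2 hne
    -- The slope is at least N/2 and the product is at most 2C, whence 4C.
    obtain ⟨N, hN⟩ := exists_nat_gt (4 * C / ‖fderiv ℝ A (s, t) (0, 1)‖)
    rw [div_lt_iff₀ hpos] at hN
    obtain ⟨D, hD, hDN⟩ := exists_hasDerivAt_coboundary hF hF1 hFG N s
    have hit := fun s t => twisted_iterate hFG (κ := fun _ => Complex.exp (2 * π * Complex.I * θ))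
      h N s t
    have hb := norm_twisted_le (m := 0) (s := s) hAd hit (hasDerivAt_iterateShift hD)
      (by simpa using hasDerivAt_const s _) (by simp [norm_exp_two_pi_I]) hC t
    simp only [Complex.ofReal_zero, mul_zero, zero_mul, sub_zero, norm_mul, Complex.norm_real,
      norm_eq_abs] at hb
    have hd1 : (1 : ℝ) ≤ |(d : ℝ)| := by exact_mod_cast Int.one_le_abs hd
    have hlow : (N : ℝ) / 2 ≤ |N * d + D| := by
      have h1 := abs_sub_abs_le_abs_sub (N * d : ℝ) (-D)
      rw [abs_neg, sub_neg_eq_add, abs_mul, Nat.abs_cast] at h1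
      nlinarith [(Nat.cast_nonneg N : (0 : ℝ) ≤ N)]
    nlinarith
  have hconst : ∀ s t, A (s, t) = A (s, 0) := fun s t =>
    is_const_of_deriv_eq_zero (f := fun t => A (s, t))
      (fun t => (hasDerivAt_right hAd s t).differentiableAt)
      (fun t => (hasDerivAt_right hAd s t).deriv.trans (hder s t)) t 0
  have hinv := Function.Periodic.eq_of_irrational
    (u := fun s => A (s, 0) * Complex.exp (-(2 * π * Complex.I * s))) (θ := θ)
    (by have := hA.continuous; fun_prop) hθ ?_ ?_ s
  · simp only [Complex.ofReal_zero, mul_zero, neg_zero, Complex.exp_zero, mul_one] at hinv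
    rw [hconst, ← hinv, mul_assoc, ← Complex.exp_add]
    simp
  · intro s
    have : (-(2 * π * Complex.I * ((s + 1 : ℝ) : ℂ))) =
        -(2 * π * Complex.I * s) - 2 * π * Complex.I := by push_cast; ring
    simp only [this, hAp.1, Complex.exp_periodic.sub_eq]
  -- The value of t is chosen so that the image point has second coordinate 0.
  · intro s
    have h1 := h s (-(d * s + F s))
    rw [neg_add_cancel, hconst s] at h1
    simp only [h1]
    rw [mul_comm (Complex.exp _), mul_assoc, ← Complex.exp_add]
    push_cast
    congr 2
    ring

/-- Everything comes from the estimate `key`: (Nd + D) b - 2πi N d is bounded independently of N.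
Subtracting it at two values of t shows that b depends on s only; invariance under the rotation
makes b constant; a zero of D identifies the constant as 2πi; and what is left bounds D itself. -/
theorem not_semiconj_rotation_of_not_lipschitz (hθ : Irrational θ) (hd : d ≠ 0)
    (hF : Differentiable ℝ F)
    (hG : Continuous G) (hG1 : Function.Periodic G 1) (hFG : ∀ s, F s = G s - G (s + θ))
    (hF1 : ∀ s, |deriv F s| ≤ 1 / 2) (hGeven : ∀ s, G (-s) = G s)
    (hGl : ∀ C : ℝ, ∃ h > 0, C * h < |G 0 - G h|)
    {A B : ℝ × ℝ → ℂ} (hA : ContDiff ℝ 1 A) (hAp : Biperiodic A) (hA1 : ∀ p, ‖A p‖ = 1)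
    (hB : ContDiff ℝ 1 B) (hBp : Biperiodic B) (hB1 : ∀ p, ‖B p‖ = 1)
    (hAe : ∀ s t, A (s + θ, t + (d * s + F s)) =
      Complex.exp (2 * π * Complex.I * θ) * A (s, t))
    (hBe : ∀ s t, B (s + θ, t + (d * s + F s)) = A (s, t) ^ d * B (s, t)) : False := by
  have hBd : Differentiable ℝ B := hB.differentiable (by simp)
  have hfc : ∀ v, Continuous fun p => fderiv ℝ B p v := fun v =>
    (hB.continuous_fderiv (by simp)).clm_apply continuous_const
  have hB0 : ∀ p, B p ≠ 0 := fun p => norm_pos_iff.1 (by rw [hB1]; exact one_pos)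
  obtain ⟨C, hC⟩ := (hBp.fderiv_apply (1, 0)).exists_norm_le (hfc _)
  have hκ : ∀ s t, A (s, t) ^ d =
      A (0, 0) ^ d * Complex.exp (2 * π * Complex.I * (d * s : ℝ)) := by
    intro s t
    rw [eq_exp_of_eigenfunction hθ hd hF hFG hF1 hA hAp hAe, mul_zpow, ← Complex.exp_int_mul]
    congr 2
    push_cast
    ring
  have hBe' : ∀ s t, B (s + θ, t + (d * s + F s)) =
      (A (0, 0) ^ d * Complex.exp (2 * π * Complex.I * (d * s : ℝ))) * B (s, t) := fun s t => by
    rw [hBe, hκ]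
  -- the logarithmic derivative in the second variable
  let b : ℝ × ℝ → ℂ := fun p => fderiv ℝ B p (0, 1) / B p
  have key : ∀ (N : ℕ) (s t D : ℝ), HasDerivAt (fun s => G s - G (s + N * θ)) D s →
      ‖((N * d + D : ℝ) : ℂ) * b (s, t) - 2 * π * Complex.I * ((N * d : ℝ) : ℂ)‖ ≤ 2 * C := by
    intro N s t D hD
    have hit := fun s t => twisted_iterate hFG hBe' N s t
    simp only [prod_exp_affine] at hit
    have hb := norm_twisted_le (m := N * d) (s := s) hBd hit (hasDerivAt_iterateShift hD)
      ?_ ?_ hC t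
    · have : ((N * d + D : ℝ) : ℂ) * b (s, t) - 2 * π * Complex.I * ((N * d : ℝ) : ℂ) =
        (((N * d + D : ℝ) : ℂ) * fderiv ℝ B (s, t) (0, 1) -
          2 * π * Complex.I * ((N * d : ℝ) : ℂ) * B (s, t)) / B (s, t) := by
        have := hB0 (s, t)
        simp only [b]
        field_simp
      rw [this, norm_div, hB1, div_one]
      exact hb
    · have h1 : HasDerivAt (fun s : ℝ => (2 * π * Complex.I *
        ((N * d * s + d * θ * (N * (N - 1) / 2) : ℝ) : ℂ))) (2 * π * Complex.I *
          ((N * d : ℝ) : ℂ)) s := by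
        have h0 : HasDerivAt (fun s : ℝ => (N * d * s + d * θ * (N * (N - 1) / 2) : ℝ))
            (N * d : ℝ) s := by
          simpa using ((hasDerivAt_id s).const_mul ((N : ℝ) * d)).add_const
            (d * θ * (N * (N - 1) / 2))
        exact h0.ofReal_comp.const_mul _
      refine (h1.cexp.const_mul ((A (0, 0) ^ d) ^ N)).congr_deriv ?_
      ring
    · rw [norm_mul, norm_pow, norm_zpow, hA1, norm_exp_two_pi_I]
      simp
  have hd1 : (1 : ℝ) ≤ |(d : ℝ)| := by exact_mod_cast Int.one_le_abs hd
  have hbt : ∀ s t, b (s, t) = b (s, 0) := by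
    intro s t
    by_contra hne
    have hpos : 0 < ‖b (s, t) - b (s, 0)‖ := norm_pos_iff.2 (sub_ne_zero.2 hne)
    -- Two instances of `key` differ by at most 4C, against a slope of at least N/2.
    obtain ⟨N, hN⟩ := exists_nat_gt (8 * C / ‖b (s, t) - b (s, 0)‖)
    rw [div_lt_iff₀ hpos] at hN
    obtain ⟨D, hD, hDN⟩ := exists_hasDerivAt_coboundary hF hF1 hFG N s
    have h1 := norm_sub_le_of_le (key N s t D hD) (key N s 0 D hD)
    rw [sub_sub_sub_cancel_right, ← mul_sub, norm_mul, Complex.norm_real, norm_eq_abs] at h1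
    have hlow : (N : ℝ) / 2 ≤ |N * d + D| := by
      have h1 := abs_sub_abs_le_abs_sub (N * d : ℝ) (-D)
      rw [abs_neg, sub_neg_eq_add, abs_mul, Nat.abs_cast] at h1
      nlinarith [(Nat.cast_nonneg N : (0 : ℝ) ≤ N)]
    nlinarith
  have hbc : Continuous b := (hfc _).div hB.continuous hB0
  have hbs : ∀ s t, b (s, t) = b (0, 0) := by
    intro s t
    rw [hbt]
    refine Function.Periodic.eq_of_irrational (u := fun s => b (s, 0)) (by fun_prop) hθ ?_ ?_ s
    · intro s
      simp only [b, hBp.1, (hBp.fderiv_apply (0, 1)).1]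
    · intro s
      have h1 : b (s + θ, 0 + (d * s + F s)) = b (s, 0) := by
        simp only [b]
        rw [fderiv_right_of_twisted hBd hBe' s 0, hBe', mul_div_mul_left]
        refine mul_ne_zero (zpow_ne_zero _ (norm_pos_iff.1 ?_)) (Complex.exp_ne_zero _)
        rw [hA1]; exact one_pos
      exact (hbt _ _).symm.trans h1
  have hb2 : b (0, 0) = 2 * π * Complex.I := by
    by_contra hne
    have hpos : 0 < ‖b (0, 0) - 2 * π * Complex.I‖ := norm_pos_iff.2 (sub_ne_zero.2 hne)
    obtain ⟨N, hN⟩ := exists_nat_gt (2 * C / ‖b (0, 0) - 2 * π * Complex.I‖)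
    rw [div_lt_iff₀ hpos] at hN
    choose D hD _ using exists_hasDerivAt_coboundary hF hF1 hFG N
    -- Rolle's theorem on one period gives a point with D = 0, where `key` reads N |d| |b - 2πi| ≤
    -- 2C.
    obtain ⟨s, -, hs⟩ := exists_hasDerivAt_eq_zero (f := fun s => G s - G (s + N * θ)) (f' := D)
      (zero_lt_one' ℝ) (by fun_prop) (by
        have h1 := hG1 0
        have h2 := hG1 (N * θ)
        rw [zero_add] at h1
        simp only [zero_add, h1, add_comm (1 : ℝ), h2]) (fun s _ => hD s)
    have h1 := key N s 0 (D s) (hD s)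
    rw [hs, add_zero, hbs, mul_comm, ← sub_mul, norm_mul, Complex.norm_real, norm_eq_abs, abs_mul,
      Nat.abs_cast] at h1
    have h3 : (N : ℝ) ≤ N * |(d : ℝ)| := le_mul_of_one_le_right (Nat.cast_nonneg N) hd1
    nlinarith
  -- With b = 2πi the terms in Nd cancel in `key`, leaving 2π |D| ≤ 2C.
  have hlip : ∀ (N : ℕ) (s s' : ℝ),
      |(G s - G (s + N * θ)) - (G s' - G (s' + N * θ))| ≤ 2 * C * |s - s'| := by
    intro N s s'
    choose D hD _ using exists_hasDerivAt_coboundary hF hF1 hFG N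
    refine convex_univ.norm_image_sub_le_of_norm_hasDerivWithin_le
      (f := fun s => G s - G (s + N * θ)) (f' := D)
      (fun x _ => (hD x).hasDerivWithinAt) (fun x _ => ?_) (Set.mem_univ s') (Set.mem_univ s)
    have h1 := key N x 0 (D x) (hD x)
    rw [hbs, hb2] at h1
    have h2 : ((N * d + D x : ℝ) : ℂ) * (2 * π * Complex.I) -
        2 * π * Complex.I * ((N * d : ℝ) : ℂ) = ((2 * π * D x : ℝ) : ℂ) * Complex.I := by
      push_cast; ring
    rw [h2, norm_mul, Complex.norm_I, mul_one, Complex.norm_real, norm_mul] at h1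
    have h3 : (1 : ℝ) ≤ ‖2 * π‖ := by
      rw [norm_of_nonneg (by positivity)]
      linarith [pi_gt_three]
    exact (le_mul_of_one_le_left (norm_nonneg _) h3).trans h1
  obtain ⟨h, hh, hlt⟩ := hGl C
  -- With τ = -h and the points 0 and h, evenness turns the difference into 2(G(0) - G(h)), so the
  -- two contributions add up instead of cancelling.
  have h1 := lipschitz_of_coboundary_lipschitz hθ hG hG1 hlip (-h) 0 h
  rw [zero_add, hGeven, add_neg_cancel, zero_sub, abs_neg, abs_of_pos hh,
    show G 0 - G h - (G h - G 0) = 2 * (G 0 - G h) by ring, abs_mul, abs_two] at h1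
  linarith

end CohomologicalEquation

/-! ### Smooth functions on the circle and their periodic lifts. -/

section CircleMaps
open Real

attribute [local instance] finrank_real_complex_fact'

theorem contMDiff_coe_circle {m : ℕ∞ω} :
    ContMDiff (𝓡 1) 𝓘(ℝ, ℂ) m (fun z : Circle => (z : ℂ)) :=
  contMDiff_coe_sphere

instance {m : ℕ∞ω} : LieGroup (𝓡 1) m Circle := LieGroup.of_le (n := ω) le_top

theorem contMDiff_zpow_circle {m : ℕ∞ω} (d : ℤ) :
    ContMDiff (𝓡 1) (𝓡 1) m (fun z : Circle => z ^ d) := by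
  obtain ⟨N, rfl | rfl⟩ := d.eq_nat_or_neg
  · simpa using contMDiff_pow N
  · simpa using (contMDiff_pow (I := 𝓡 1) (G := Circle) N).inv

/-- The parametrization `s ↦ e^{2πis}` of the circle. -/
noncomputable def circleParam (s : ℝ) : Circle := Circle.exp (2 * π * s)

theorem circleParam_add (s t : ℝ) : circleParam (s + t) = circleParam s * circleParam t := by
  rw [circleParam, mul_add, Circle.exp_add]; rfl

theorem circleParam_neg (s : ℝ) : circleParam (-s) = (circleParam s)⁻¹ := by
  rw [circleParam, mul_neg, Circle.exp_neg]; rfl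

theorem circleParam_intCast (n : ℤ) : circleParam n = 1 := by
  rw [circleParam, mul_comm, Circle.exp_int_mul_two_pi]

theorem circleParam_eq_iff {s t : ℝ} : circleParam s = circleParam t ↔ ∃ n : ℤ, s = t + n := by
  rw [circleParam, circleParam, Circle.exp_eq_exp]
  refine exists_congr fun n => ?_
  have := pi_pos
  constructor
  · intro h
    have : 2 * π * s = 2 * π * (t + n) := by rw [h]; ring
    exact mul_left_cancel₀ (by positivity) this
  · rintro rfl; ring

theorem circleParam_periodic : Function.Periodic circleParam 1 := fun s => by
  rw [circleParam_add]
  simpa using congrArg (circleParam s * ·) (circleParam_intCast 1)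

theorem circleParam_intCast_mul (d : ℤ) (s : ℝ) : circleParam (d * s) = circleParam s ^ d := by
  rw [circleParam, mul_left_comm, Circle.exp_intCast_mul]; rfl

theorem coe_circleParam (s : ℝ) :
    (circleParam s : ℂ) = Complex.exp (2 * π * Complex.I * s) := by
  rw [circleParam, Circle.coe_exp]
  push_cast
  ring_nf

theorem circleParam_arg (z : Circle) : circleParam (Complex.arg z / (2 * π)) = z := by
  rw [circleParam, mul_div_cancel₀ _ (by positivity), Circle.exp_arg]

theorem contMDiff_circleParam {m : ℕ∞ω} : ContMDiff 𝓘(ℝ, ℝ) (𝓡 1) m circleParam :=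
  contMDiff_circleExp.comp (contDiff_const.mul contDiff_id).contMDiff

theorem continuous_circleParam : Continuous circleParam :=
  (contMDiff_circleParam (m := 0)).continuous

/-- The function on the circle with a given `1`-periodic lift. -/
noncomputable def circleFun (F : ℝ → ℝ) (z : Circle) : ℝ := F (Complex.arg z / (2 * π))

theorem circleFun_circleParam {F : ℝ → ℝ} (hF : Function.Periodic F 1) (s : ℝ) :
    circleFun F (circleParam s) = F s := by
  obtain ⟨n, hn⟩ := circleParam_eq_iff.1 (circleParam_arg (circleParam s))
  rw [circleFun, hn]
  simpa using (hF.int_mul n) s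

/-- The definition uses `Complex.arg`, which jumps at -1. Rotating the base point `circleParam s` to
1 gives a formula in which the argument is smooth near that point. -/
theorem circleFun_eq {F : ℝ → ℝ} (hF : Function.Periodic F 1) (s : ℝ) (z : Circle) :
    circleFun F z = F (s + Complex.arg (z * (circleParam s)⁻¹ : Circle) / (2 * π)) := by
  rw [← circleFun_circleParam hF, circleParam_add, circleParam_arg]
  congr 1
  exact (mul_inv_cancel_comm_assoc _ _).symm

theorem contMDiff_circleFun {m : ℕ∞ω} {F : ℝ → ℝ} (hF : Function.Periodic F 1)
    (hc : ContDiff ℝ m F) : ContMDiff (𝓡 1) 𝓘(ℝ, ℝ) m (circleFun F) := by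
  intro z
  obtain ⟨s, rfl⟩ : ∃ s, circleParam s = z := ⟨_, circleParam_arg z⟩
  rw [funext (circleFun_eq hF s)]
  have harg : ContDiffAt ℝ m Complex.arg (((circleParam s * (circleParam s)⁻¹ : Circle)) : ℂ) := by
    rw [mul_inv_cancel, Circle.coe_one]
    have h := Complex.imCLM.contDiff.contDiffAt.comp (1 : ℂ)
      ((Complex.contDiffAt_log (n := m) Complex.one_mem_slitPlane).restrict_scalars ℝ)
    exact h.congr_of_eventuallyEq (Filter.Eventually.of_forall fun z => (Complex.log_im z).symm)
  have h1 : ContMDiffAt (𝓡 1) 𝓘(ℝ, ℂ) m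
      (fun z : Circle => ((z * (circleParam s)⁻¹ : Circle) : ℂ)) (circleParam s) :=
    contMDiff_coe_circle.contMDiffAt.comp _ (contMDiff_id.mul contMDiff_const).contMDiffAt
  have h2 := harg.contMDiffAt.comp (circleParam s) h1
  have h3 : ContDiff ℝ m fun x : ℝ => F (s + x / (2 * π)) :=
    hc.comp (contDiff_const.add (contDiff_id.div_const _))
  exact h3.contMDiff.contMDiffAt.comp _ h2

theorem continuous_circleFun {F : ℝ → ℝ} (hF : Function.Periodic F 1)
    (hc : Continuous F) : Continuous (circleFun F) :=
  (contMDiff_circleFun (m := 0) hF (contDiff_zero.2 hc)).continuous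

end CircleMaps

/-! ### Furstenberg diffeomorphisms, the continuous conjugacy, and the absence of a C¹ one. -/

section Furstenberg

theorem furstenberg_eq (θ : ℝ) (d : ℤ) (f : Circle → ℝ) (q : Torus) :
    furstenberg θ d f q = (q.1 * circleParam θ, q.1 ^ d * q.2 * circleParam (f q.1)) := rfl

theorem contMDiff_furstenberg (θ : ℝ) (d : ℤ) {f : Circle → ℝ} {m : ℕ∞ω}
    (hf : ContMDiff (𝓡 1) 𝓘(ℝ, ℝ) m f) :
    ContMDiff ((𝓡 1).prod (𝓡 1)) ((𝓡 1).prod (𝓡 1)) m (furstenberg θ d f) := by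
  refine (contMDiff_fst.mul contMDiff_const).prodMk ((ContMDiff.mul ?_ contMDiff_snd).mul ?_)
  · exact (contMDiff_zpow_circle d).comp contMDiff_fst
  · exact contMDiff_circleParam.comp (hf.comp contMDiff_fst)

/-- The inverse of a Furstenberg map. -/
noncomputable def furstenbergInv (θ : ℝ) (d : ℤ) (f : Circle → ℝ) (q : Torus) : Torus :=
  (q.1 * circleParam (-θ),
    (q.1 * circleParam (-θ)) ^ (-d) * q.2 * circleParam (-(f (q.1 * circleParam (-θ)))))

theorem contMDiff_furstenbergInv (θ : ℝ) (d : ℤ) {f : Circle → ℝ} {m : ℕ∞ω}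
    (hf : ContMDiff (𝓡 1) 𝓘(ℝ, ℝ) m f) :
    ContMDiff ((𝓡 1).prod (𝓡 1)) ((𝓡 1).prod (𝓡 1)) m (furstenbergInv θ d f) := by
  have h1 : ContMDiff ((𝓡 1).prod (𝓡 1)) (𝓡 1) m
      (fun q : Torus => q.1 * circleParam (-θ)) := contMDiff_fst.mul contMDiff_const
  refine h1.prodMk ((ContMDiff.mul ?_ contMDiff_snd).mul ?_)
  · exact (contMDiff_zpow_circle (-d)).comp h1
  · exact contMDiff_circleParam.comp (hf.comp h1).neg

theorem leftInverse_furstenbergInv (θ : ℝ) (d : ℤ) (f : Circle → ℝ) :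
    Function.LeftInverse (furstenbergInv θ d f) (furstenberg θ d f) := by
  rintro ⟨x, y⟩
  simp only [furstenberg_eq, furstenbergInv, circleParam_neg, mul_inv_cancel_right, zpow_neg]
  refine Prod.ext rfl ?_
  simp only
  rw [mul_assoc (x ^ d), inv_mul_cancel_left, mul_inv_cancel_right]

theorem rightInverse_furstenbergInv (θ : ℝ) (d : ℤ) (f : Circle → ℝ) :
    Function.RightInverse (furstenbergInv θ d f) (furstenberg θ d f) := by
  rintro ⟨x, y⟩
  simp only [furstenberg_eq, furstenbergInv, circleParam_neg, inv_mul_cancel_right, zpow_neg]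
  refine Prod.ext rfl ?_
  simp only
  rw [mul_assoc, mul_assoc, inv_mul_cancel, mul_one, mul_inv_cancel_left]

variable {n : ℕ} (M : Type*) [TopologicalSpace M] [ChartedSpace (EuclideanSpace ℝ (Fin n)) M]

/-- The diffeomorphism `id × φ_{θ,d,f}` of `M × T²`. -/
noncomputable def furstenbergDiffeo (θ : ℝ) (d : ℤ) {f : Circle → ℝ}
    (hf : ContMDiff (𝓡 1) 𝓘(ℝ, ℝ) ∞ f) :
    Diffeomorph (bundleModel n) (bundleModel n) (M × Torus) (M × Torus) ∞ where
  toFun := Prod.map id (furstenberg θ d f)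
  invFun := Prod.map id (furstenbergInv θ d f)
  left_inv := Function.LeftInverse.prodMap (fun _ => rfl) (leftInverse_furstenbergInv θ d f)
  right_inv := Function.RightInverse.prodMap (fun _ => rfl) (rightInverse_furstenbergInv θ d f)
  contMDiff_toFun := contMDiff_id.prodMap (contMDiff_furstenberg θ d hf)
  contMDiff_invFun := contMDiff_id.prodMap (contMDiff_furstenbergInv θ d hf)

/-- The homeomorphism `(m, x, y) ↦ (m, x, y e^{2πi g(x)})` of `M × T²`. -/
noncomputable def fiberRotation {g : Circle → ℝ} (hg : Continuous g) :
    (M × Torus) ≃ₜ (M × Torus) where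
  toFun p := (p.1, p.2.1, circleParam (g p.2.1) * p.2.2)
  invFun p := (p.1, p.2.1, circleParam (-g p.2.1) * p.2.2)
  left_inv p := by simp [circleParam_neg]
  right_inv p := by simp [circleParam_neg]
  continuous_toFun := by have := continuous_circleParam; fun_prop
  continuous_invFun := by have := continuous_circleParam; fun_prop

theorem fiberRotation_apply {g : Circle → ℝ} (hg : Continuous g) (p : M × Torus) :
    fiberRotation M hg p = (p.1, p.2.1, circleParam (g p.2.1) * p.2.2) := rfl

theorem fiberRotation_semiconj {θ : ℝ} (d : ℤ) {f g : Circle → ℝ} (hg : Continuous g)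
    (hfg : ∀ x, f x = g x - g (x * circleParam θ)) :
    ⇑(fiberRotation M hg) ∘ Prod.map id (furstenberg θ d f) =
      Prod.map id (furstenberg θ d 0) ∘ ⇑(fiberRotation M hg) := by
  funext ⟨m, x, y⟩
  have h0 : circleParam 0 = 1 := by simpa using circleParam_intCast 0
  simp only [Function.comp_apply, Prod.map_apply, furstenberg_eq, fiberRotation_apply, id, Pi.zero_apply, hfg, h0, mul_one]
  refine Prod.ext rfl (Prod.ext rfl ?_)
  simp only
  rw [sub_eq_add_neg, circleParam_add, circleParam_neg]
  have (a b c e : Circle) : a * (b * c * (e * a⁻¹)) = b * (e * c) := by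
    rw [mul_comm (b * c), ← mul_assoc, mul_comm e, mul_inv_cancel_left, mul_left_comm]
  exact this _ _ _ _

-- The factor M plays no role: both maps are the identity on it, so it suffices to restrict ψ to one
-- torus {m} × T², lift to the plane, and keep the two torus components.
variable {M} in
theorem not_exists_contMDiff_semiconj {θ : ℝ} {d : ℤ} {F G : ℝ → ℝ} [Nonempty M]
    (hθ : Irrational θ) (hd : d ≠ 0)
    (hF : Differentiable ℝ F) (hFp : Function.Periodic F 1)
    (hG : Continuous G) (hG1 : Function.Periodic G 1) (hFG : ∀ s, F s = G s - G (s + θ))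
    (hF1 : ∀ s, |deriv F s| ≤ 1 / 2) (hGeven : ∀ s, G (-s) = G s)
    (hGl : ∀ C : ℝ, ∃ h > 0, C * h < |G 0 - G h|) :
    ¬ ∃ ψ : M × Torus → M × Torus, ContMDiff (bundleModel n) (bundleModel n) 1 ψ ∧
      ψ ∘ Prod.map id (furstenberg θ d (circleFun F)) =
        Prod.map id (furstenberg θ d 0) ∘ ψ := by
  rintro ⟨ψ, hψ, hc⟩
  obtain ⟨m⟩ := ‹Nonempty M›
  have h0 : circleParam 0 = 1 := by simpa using circleParam_intCast 0
  let E : ℝ × ℝ → M × Torus := fun p => (m, circleParam p.1, circleParam p.2)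
  have hE : ContMDiff 𝓘(ℝ, ℝ × ℝ) (bundleModel n) 1 E :=
    contMDiff_const.prodMk ((contMDiff_circleParam.comp contDiff_fst.contMDiff).prodMk
      (contMDiff_circleParam.comp contDiff_snd.contMDiff))
  have hψE := hψ.comp hE
  have hAB : ∀ s t, ψ (E (s + θ, t + (d * s + F s))) =
      Prod.map id (furstenberg θ d 0) (ψ (E (s, t))) := by
    intro s t
    rw [← Function.comp_apply (f := Prod.map id (furstenberg θ d 0)), ← hc]
    simp only [Function.comp_apply, E, Prod.map_apply, furstenberg_eq, id,
      circleFun_circleParam hFp, circleParam_add, circleParam_intCast_mul]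
    congr 3
    rw [mul_left_comm, mul_assoc]
  have hE1 : ∀ s t, E (s + 1, t) = E (s, t) := fun s t => by simp only [E, circleParam_periodic s]
  have hE2 : ∀ s t, E (s, t + 1) = E (s, t) := fun s t => by simp only [E, circleParam_periodic t]
  refine not_semiconj_rotation_of_not_lipschitz hθ hd hF hG hG1 hFG hF1 hGeven hGl
    (A := fun p => ((ψ (E p)).2.1 : ℂ)) (B := fun p => ((ψ (E p)).2.2 : ℂ)) ?_ ?_ ?_ ?_ ?_ ?_ ?_ ?_
  · exact (contMDiff_coe_circle.comp
      (contMDiff_fst.comp (contMDiff_snd.comp hψE))).contDiff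
  · exact ⟨fun s t => by simp only [hE1], fun s t => by simp only [hE2]⟩
  · exact fun p => Circle.norm_coe _
  · exact (contMDiff_coe_circle.comp
      (contMDiff_snd.comp (contMDiff_snd.comp hψE))).contDiff
  · exact ⟨fun s t => by simp only [hE1], fun s t => by simp only [hE2]⟩
  · exact fun p => Circle.norm_coe _
  · intro s t
    simp only [hAB, Prod.map_apply', furstenberg_eq, Circle.coe_mul, coe_circleParam]
    ring
  · intro s t
    simp only [hAB, furstenberg_eq, Circle.coe_mul, Prod.map_snd, Pi.zero_apply, h0,
      mul_one, Circle.coe_zpow]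

end Furstenberg

/-! ### Pullbacks and wedge products of forms. -/

section Wedge

theorem AlternatingMap.domCoprod_compLinearMap {ι κ V W : Type*} [Fintype ι] [DecidableEq ι]
    [Fintype κ] [DecidableEq κ] [AddCommGroup V] [Module ℝ V] [AddCommGroup W] [Module ℝ W]
    (a : W [⋀^ι]→ₗ[ℝ] ℝ) (b : W [⋀^κ]→ₗ[ℝ] ℝ) (L : V →ₗ[ℝ] W) :
    (a.domCoprod b).compLinearMap L = (a.compLinearMap L).domCoprod (b.compLinearMap L) := by
  ext v
  simp only [AlternatingMap.compLinearMap_apply, AlternatingMap.domCoprod_apply,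
    _root_.sum_apply]
  refine Finset.sum_congr rfl fun σ _ => ?_
  induction σ using Quotient.inductionOn' with | _ σ
  rfl

variable {E : Type*} [NormedAddCommGroup E] [NormedSpace ℝ E]
  {H : Type*} [TopologicalSpace H] {I : ModelWithCorners ℝ E H}
  {F : Type*} [NormedAddCommGroup F] [NormedSpace ℝ F]
  {G : Type*} [TopologicalSpace G] {J : ModelWithCorners ℝ F G}
  {E' : Type*} [NormedAddCommGroup E'] [NormedSpace ℝ E']
  {H' : Type*} [TopologicalSpace H'] {I' : ModelWithCorners ℝ E' H'}
  {M : Type*} [TopologicalSpace M] [ChartedSpace H M]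
  {N : Type*} [TopologicalSpace N] [ChartedSpace G N]
  {Q : Type*} [TopologicalSpace Q] [ChartedSpace H' Q]
  {ι κ : Type*}

theorem pullbackForm_wedgeForm [Fintype ι] [DecidableEq ι] [Fintype κ] [DecidableEq κ]
    (φ : M → N) (α : FormField J N ι) (η : FormField J N κ) :
    pullbackForm I J φ (wedgeForm J α η) =
      wedgeForm I (pullbackForm I J φ α) (pullbackForm I J φ η) := by
  funext p
  simp only [pullbackForm, wedgeForm, ← AlternatingMap.domCoprod_compLinearMap]
  rfl

theorem pullbackForm_comp_apply {φ : M → N} {χ : N → Q} {p : M}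
    (hχ : MDifferentiableAt J I' χ (φ p)) (hφ : MDifferentiableAt I J φ p)
    (α : FormField I' Q ι) :
    pullbackForm I J φ (pullbackForm J I' χ α) p = pullbackForm I I' (χ ∘ φ) α p := by
  simp only [pullbackForm]
  rw [mfderiv_comp p hχ hφ]
  rfl

theorem pullbackForm_comp {φ : M → N} {χ : N → Q}
    (hχ : MDifferentiable J I' χ) (hφ : MDifferentiable I J φ) (α : FormField I' Q ι) :
    pullbackForm I J φ (pullbackForm J I' χ α) = pullbackForm I I' (χ ∘ φ) α :=
  funext fun p => pullbackForm_comp_apply (hχ (φ p)) (hφ p) α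

theorem pullbackForm_prodMap_id [Fintype ι] [DecidableEq ι] [Fintype κ] [DecidableEq κ]
    {φ : N → N} (hφ : MDifferentiable J J φ) (α : FormField I M ι) (η : FormField J N κ) :
    pullbackForm (I.prod J) (I.prod J) (Prod.map id φ) (prodForm I J α η) =
      prodForm I J α (pullbackForm J J φ η) := by
  have h : MDifferentiable (I.prod J) (I.prod J) (Prod.map id φ : M × N → M × N) :=
    mdifferentiable_id.prodMap hφ
  simp only [prodForm]
  rw [pullbackForm_wedgeForm, pullbackForm_comp mdifferentiable_fst h,
    pullbackForm_comp mdifferentiable_snd h, pullbackForm_comp hφ mdifferentiable_snd]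
  rfl

theorem wedgeForm_add_right [Fintype ι] [DecidableEq ι] [Fintype κ] [DecidableEq κ]
    (α : FormField I M ι) (η η' : FormField I M κ) :
    wedgeForm I α (η + η') = wedgeForm I α η + wedgeForm I α η' := by
  funext p
  simp only [wedgeForm, Pi.add_apply, ← AlternatingMap.domCoprod'_apply, TensorProduct.tmul_add,
    map_add]
  ext v
  simp

theorem pullbackForm_zero (φ : M → N) :
    pullbackForm I J φ (0 : FormField J N ι) = 0 := rfl

theorem formField_eq_zero [FiniteDimensional ℝ E] [Fintype ι]
    (h : Module.finrank ℝ E < Fintype.card ι) (α : FormField I M ι) : α = 0 := by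
  funext p
  ext v
  refine (α p).map_linearDependent v fun hv => ?_
  have : FiniteDimensional ℝ (TangentSpace I p) := inferInstanceAs (FiniteDimensional ℝ E)
  exact absurd hv.fintype_card_le_finrank (not_le.2 h)

end Wedge

/-! ### Invariance of the product volume form. -/

section CircleForm

variable {E : Type*} [NormedAddCommGroup E] [NormedSpace ℝ E]
  {H : Type*} [TopologicalSpace H] {I : ModelWithCorners ℝ E H}
  {M : Type*} [TopologicalSpace M] [ChartedSpace H M]

theorem mdifferentiable_coe_circle : MDifferentiable (𝓡 1) 𝓘(ℝ, ℂ) (fun z : Circle => (z : ℂ)) :=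
  (contMDiff_coe_circle (m := 1)).mdifferentiable one_ne_zero

/-- The form `(2πi)⁻¹ z̄ dz` on the plane, up to a real part that vanishes on the circle. -/
noncomputable def angularForm (z w : ℂ) : ℝ := (2 * Real.pi)⁻¹ * (star z * w).im

theorem angularForm_mul (z w : Circle) (a b : ℂ) :
    angularForm (z * w : Circle) (z * b + w * a) = angularForm z a + angularForm w b := by
  have hz : star (z : ℂ) * (z : ℂ) = 1 := by
    simpa [Circle.normSq_coe] using (Complex.normSq_eq_conj_mul_self (z := (z : ℂ))).symm
  have hw : star (w : ℂ) * (w : ℂ) = 1 := by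
    simpa [Circle.normSq_coe] using (Complex.normSq_eq_conj_mul_self (z := (w : ℂ))).symm
  rw [angularForm, angularForm, angularForm, ← mul_add, ← Complex.add_im]
  congr 2
  rw [Circle.coe_mul, star_mul]
  linear_combination a * star (z : ℂ) * hw + b * star (w : ℂ) * hz

theorem pullbackForm_circleForm_apply {u : M → Circle} {p : M}
    (hu : MDifferentiableAt I (𝓡 1) u p) (v : Fin 1 → TangentSpace I p) :
    pullbackForm I (𝓡 1) u circleForm p v =
      angularForm (u p) (mfderiv I 𝓘(ℝ, ℂ) (fun q => (u q : ℂ)) p (v 0)) := by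
  have h : mfderiv I 𝓘(ℝ, ℂ) (fun q => (u q : ℂ)) p = _ :=
    mfderiv_comp p (mdifferentiable_coe_circle (u p)) hu
  rw [h]
  rfl

/-- The form is a logarithmic differential, so products become sums. -/
theorem pullbackForm_mul_circleForm {u w : M → Circle}
    (hu : MDifferentiable I (𝓡 1) u) (hw : MDifferentiable I (𝓡 1) w)
    (huw : MDifferentiable I (𝓡 1) (fun p => u p * w p)) :
    pullbackForm I (𝓡 1) (fun p => u p * w p) circleForm =
      pullbackForm I (𝓡 1) u circleForm + pullbackForm I (𝓡 1) w circleForm := by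
  funext p
  ext v
  rw [Pi.add_apply, AlternatingMap.add_apply, pullbackForm_circleForm_apply (hu p),
    pullbackForm_circleForm_apply (hw p), pullbackForm_circleForm_apply (huw p)]
  have h1 := ((mdifferentiable_coe_circle (u p)).comp p (hu p)).hasMFDerivAt.mul
    ((mdifferentiable_coe_circle (w p)).comp p (hw p)).hasMFDerivAt
  have h2 := h1.mfderiv
  have h3 : (fun q => ((u q * w q : Circle) : ℂ)) =
    ((fun z : Circle => (z : ℂ)) ∘ u) * ((fun z : Circle => (z : ℂ)) ∘ w) := rfl
  rw [h3, h2]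
  exact angularForm_mul _ _ _ _

theorem pullbackForm_const_circleForm (c : Circle) :
    pullbackForm I (𝓡 1) (fun _ : M => c) circleForm = 0 := by
  funext p
  ext v
  rw [pullbackForm_circleForm_apply mdifferentiableAt_const]
  rw [mfderiv_const]
  exact (by simp [angularForm] : angularForm c 0 = 0)

theorem pullbackForm_furstenberg_torusForm (θ : ℝ) (d : ℤ) {f : Circle → ℝ}
    (hf : ContMDiff (𝓡 1) 𝓘(ℝ, ℝ) ∞ f) :
    pullbackForm ((𝓡 1).prod (𝓡 1)) ((𝓡 1).prod (𝓡 1)) (furstenberg θ d f) torusForm =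
      torusForm := by
  have hφ : MDifferentiable ((𝓡 1).prod (𝓡 1)) ((𝓡 1).prod (𝓡 1)) (furstenberg θ d f) :=
    (contMDiff_furstenberg θ d hf).mdifferentiable (by simp)
  let k : Circle → Circle := fun x => x ^ d * circleParam (f x)
  have hk : MDifferentiable (𝓡 1) (𝓡 1) k :=
    ((contMDiff_zpow_circle d).mul (contMDiff_circleParam.comp hf)).mdifferentiable (by simp)
  have hfst : MDifferentiable ((𝓡 1).prod (𝓡 1)) (𝓡 1) (Prod.fst : Torus → Circle) :=
    mdifferentiable_fst
  have hsnd : MDifferentiable ((𝓡 1).prod (𝓡 1)) (𝓡 1) (Prod.snd : Torus → Circle) :=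
    mdifferentiable_snd
  have h1 : Prod.fst ∘ furstenberg θ d f = fun q : Torus => q.1 * circleParam θ := rfl
  have h2 : Prod.snd ∘ furstenberg θ d f = fun q : Torus => (k ∘ Prod.fst) q * q.2 := by
    funext q
    exact mul_right_comm _ _ _
  -- The extra term dx ∧ k^*dx is pulled back from a 2-form on the one-dimensional first circle, so
  -- it vanishes.
  have h3 : wedgeForm ((𝓡 1).prod (𝓡 1))
      (pullbackForm ((𝓡 1).prod (𝓡 1)) (𝓡 1) (Prod.fst : Torus → Circle) circleForm)
      (pullbackForm ((𝓡 1).prod (𝓡 1)) (𝓡 1) (k ∘ (Prod.fst : Torus → Circle)) circleForm) = 0 := by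
    rw [← pullbackForm_comp hk hfst, ← pullbackForm_wedgeForm,
      formField_eq_zero (by simp) (wedgeForm (𝓡 1) circleForm _), pullbackForm_zero]
  rw [torusForm, prodForm, pullbackForm_wedgeForm, pullbackForm_comp hfst hφ,
    pullbackForm_comp hsnd hφ, h1, h2,
    pullbackForm_mul_circleForm hfst mdifferentiable_const (h1 ▸ hfst.comp hφ),
    pullbackForm_const_circleForm, add_zero,
    pullbackForm_mul_circleForm (hk.comp hfst) hsnd (h2 ▸ hsnd.comp hφ),
    wedgeForm_add_right, h3, zero_add]

theorem pullbackForm_furstenberg_bundleForm {n : ℕ} {M : Type*} [TopologicalSpace M]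
    [ChartedSpace (EuclideanSpace ℝ (Fin n)) M] (μ : FormField (𝓡 n) M (Fin n))
    (θ : ℝ) (d : ℤ) {f : Circle → ℝ} (hf : ContMDiff (𝓡 1) 𝓘(ℝ, ℝ) ∞ f) :
    pullbackForm (bundleModel n) (bundleModel n) (Prod.map id (furstenberg θ d f))
      (bundleForm μ) = bundleForm μ := by
  rw [bundleForm, pullbackForm_prodMap_id
    ((contMDiff_furstenberg θ d hf).mdifferentiable (by simp)),
    pullbackForm_furstenberg_torusForm θ d hf]

end CircleForm

/-! ### Chart measures of product forms. -/

section ProductMeasure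

/-- A shuffle outside the identity class feeds some right-hand vector to a, where its first
component is 0. Only the identity class survives, as for a block triangular determinant. -/
theorem AlternatingMap.domCoprod_fst_snd_apply {ι κ V W : Type*} [Fintype ι] [DecidableEq ι]
    [Fintype κ] [DecidableEq κ] [AddCommGroup V] [Module ℝ V] [AddCommGroup W] [Module ℝ W]
    (a : V [⋀^ι]→ₗ[ℝ] ℝ) (b : W [⋀^κ]→ₗ[ℝ] ℝ) (v : ι ⊕ κ → V × W)
    (hr : ∀ j, (v (Sum.inr j)).1 = 0) :
    LinearMap.mul' ℝ ℝ ((a.compLinearMap (LinearMap.fst ℝ V W)).domCoprod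
      (b.compLinearMap (LinearMap.snd ℝ V W)) v) =
      a (fun i => (v (Sum.inl i)).1) * b (fun j => (v (Sum.inr j)).2) := by
  rw [AlternatingMap.domCoprod_apply, _root_.sum_apply, map_sum]
  refine (Finset.sum_eq_single (Quotient.mk'' 1 : Equiv.Perm.ModSumCongr ι κ) ?_ ?_).trans ?_
  · intro σ _ hσ
    induction σ using Quotient.inductionOn' with | _ σ
    rw [AlternatingMap.domCoprod.summand_mk'']
    have hex : ∃ i j, σ (Sum.inl i) = Sum.inr j := by
      by_contra! hne
      apply hσ
      refine Quotient.sound' (QuotientGroup.leftRel_apply.2 ?_)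
      have hmem : σ ∈ (Equiv.Perm.sumCongrHom ι κ).range := by
        refine Equiv.Perm.mem_sumCongrHom_range_of_perm_mapsTo_inl ?_
        rintro _ ⟨i, rfl⟩
        rcases h : σ (Sum.inl i) with i' | j
        · exact ⟨i', rfl⟩
        · exact absurd h (hne i j)
      simpa using inv_mem hmem
    obtain ⟨i, j, hij⟩ := hex
    have h0 : a (fun i => (v (σ (Sum.inl i))).1) = 0 :=
      a.map_coord_zero i (by rw [hij, hr])
    simp [h0]
  · simp
  · rw [AlternatingMap.domCoprod.summand_mk'']
    simp

variable {E : Type*} [NormedAddCommGroup E] [NormedSpace ℝ E]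
  {H : Type*} [TopologicalSpace H] {I : ModelWithCorners ℝ E H}
  {F : Type*} [NormedAddCommGroup F] [NormedSpace ℝ F]
  {G : Type*} [TopologicalSpace G] {J : ModelWithCorners ℝ F G}
  {M : Type*} [TopologicalSpace M] [ChartedSpace H M]
  {N : Type*} [TopologicalSpace N] [ChartedSpace G N]
  {ι κ : Type*}

theorem mdifferentiableAt_extChartAt_symm [I.Boundaryless] [IsManifold I 1 M] {x : M} {u : E}
    (hu : u ∈ (extChartAt I x).target) :
    MDifferentiableAt 𝓘(ℝ, E) I (extChartAt I x).symm u :=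
  (mdifferentiableOn_extChartAt_symm u hu).mdifferentiableAt
    ((isOpen_extChartAt_target x).mem_nhds hu)

theorem localForm_prodForm [I.Boundaryless] [J.Boundaryless] [IsManifold I 1 M] [IsManifold J 1 N]
    [Fintype ι] [DecidableEq ι] [Fintype κ] [DecidableEq κ]
    (b : Module.Basis ι ℝ E) (c : Module.Basis κ ℝ F)
    (α : FormField I M ι) (η : FormField J N κ) (x : M) (y : N) {u : E} {w : F}
    (hu : u ∈ (extChartAt I x).target) (hw : w ∈ (extChartAt J y).target) :
    localForm (I.prod J) (prodForm I J α η) (x, y) (u, w) (b.prod c) =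
      localForm I α x u b * localForm J η y w c := by
  have hmem : (u, w) ∈ (extChartAt (I.prod J) (x, y)).target := by
    rw [extChartAt_prod]; exact ⟨hu, hw⟩
  have hs := mdifferentiableAt_extChartAt_symm (I := I.prod J) hmem
  have hfst : MDifferentiableAt 𝓘(ℝ, E × F) 𝓘(ℝ, E) Prod.fst (u, w) :=
    differentiableAt_fst.mdifferentiableAt
  have hsnd : MDifferentiableAt 𝓘(ℝ, E × F) 𝓘(ℝ, F) Prod.snd (u, w) :=
    differentiableAt_snd.mdifferentiableAt
  have h1 : Prod.fst ∘ (extChartAt (I.prod J) (x, y)).symm =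
      (extChartAt I x).symm ∘ Prod.fst := by rw [extChartAt_prod]; rfl
  have h2 : Prod.snd ∘ (extChartAt (I.prod J) (x, y)).symm =
      (extChartAt J y).symm ∘ Prod.snd := by rw [extChartAt_prod]; rfl
  have e1 : pullbackForm 𝓘(ℝ, E × F) (I.prod J) (extChartAt (I.prod J) (x, y)).symm
      (pullbackForm (I.prod J) I Prod.fst α) (u, w) =
      (localForm I α x u).compLinearMap (LinearMap.fst ℝ E F) := by
    rw [pullbackForm_comp_apply mdifferentiableAt_fst hs, h1,
      ← pullbackForm_comp_apply (mdifferentiableAt_extChartAt_symm hu) hfst, pullbackForm,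
      mfderiv_eq_fderiv, fderiv_fst]
    rfl
  have e2 : pullbackForm 𝓘(ℝ, E × F) (I.prod J) (extChartAt (I.prod J) (x, y)).symm
      (pullbackForm (I.prod J) J Prod.snd η) (u, w) =
      (localForm J η y w).compLinearMap (LinearMap.snd ℝ E F) := by
    rw [pullbackForm_comp_apply mdifferentiableAt_snd hs, h2,
      ← pullbackForm_comp_apply (mdifferentiableAt_extChartAt_symm hw) hsnd, pullbackForm,
      mfderiv_eq_fderiv, fderiv_snd]
    rfl
  have e3 : localForm (I.prod J) (prodForm I J α η) (x, y) (u, w) =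
      (LinearMap.mul' ℝ ℝ).compAlternatingMap
        (((localForm I α x u).compLinearMap (LinearMap.fst ℝ E F)).domCoprod
          ((localForm J η y w).compLinearMap (LinearMap.snd ℝ E F))) := by
    rw [localForm, prodForm, pullbackForm_wedgeForm, wedgeForm, e1, e2]
    rfl
  rw [e3]
  refine (AlternatingMap.domCoprod_fst_snd_apply _ _ _ ?_).trans ?_
  · simp
  · simp

variable [MeasurableSpace E] [BorelSpace E] [MeasurableSpace F] [BorelSpace F]

theorem aemeasurable_extChartAt_symm [MeasurableSpace M] [BorelSpace M] [I.Boundaryless] (μ : Measure E) (x : M) :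
    AEMeasurable (extChartAt I x).symm (μ.restrict (extChartAt I x).target) :=
  (continuousOn_extChartAt_symm x).aemeasurable (isOpen_extChartAt_target x).measurableSet

/-- The local density of a form is measurable in every chart. -/
def HasMeasurableDensity [Fintype ι] (I : ModelWithCorners ℝ E H) (b : Module.Basis ι ℝ E)
    (α : FormField I M ι) : Prop :=
  ∀ x : M, AEMeasurable (fun u => ENNReal.ofReal |localForm I α x u b|)
    (b.addHaar.restrict (extChartAt I x).target)

theorem restrict_target_prod [Fintype ι] [Fintype κ] {b : Module.Basis ι ℝ E}
    {c : Module.Basis κ ℝ F} [SFinite b.addHaar] [SFinite c.addHaar]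
    [SecondCountableTopologyEither E F] (x : M) (y : N) :
    (b.prod c).addHaar.restrict (extChartAt (I.prod J) (x, y)).target =
      (b.addHaar.restrict (extChartAt I x).target).prod
        (c.addHaar.restrict (extChartAt J y).target) := by
  rw [Module.Basis.prod_addHaar, Measure.prod_restrict, extChartAt_prod]
  rfl

variable [I.Boundaryless] [J.Boundaryless] [IsManifold I 1 M] [IsManifold J 1 N]
    [Fintype ι] [DecidableEq ι] [Fintype κ] [DecidableEq κ]
    {b : Module.Basis ι ℝ E} {c : Module.Basis κ ℝ F}
    {α : FormField I M ι} {η : FormField J N κ}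

theorem prodForm_density_ae_eq [SFinite b.addHaar] [SFinite c.addHaar]
    [SecondCountableTopologyEither E F] (x : M) (y : N) :
    (fun z : E × F => ENNReal.ofReal |localForm I α x z.1 b| *
      ENNReal.ofReal |localForm J η y z.2 c|) =ᵐ[(b.prod c).addHaar.restrict
        (extChartAt (I.prod J) (x, y)).target]
    fun z => ENNReal.ofReal
      |localForm (I.prod J) (prodForm I J α η) (x, y) z (b.prod c)| := by
  refine ae_restrict_of_forall_mem (isOpen_extChartAt_target _).measurableSet ?_
  rintro ⟨u, w⟩ huw
  rw [extChartAt_prod] at huw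
  dsimp only
  rw [localForm_prodForm b c α η x y huw.1 huw.2, abs_mul, ENNReal.ofReal_mul (abs_nonneg _)]

theorem HasMeasurableDensity.prodForm [SFinite b.addHaar] [SFinite c.addHaar]
    [SecondCountableTopologyEither E F]
    (hα : HasMeasurableDensity I b α) (hη : HasMeasurableDensity J c η) :
    HasMeasurableDensity (I.prod J) (b.prod c) (prodForm I J α η) := by
  rintro ⟨x, y⟩
  refine AEMeasurable.congr ?_ (prodForm_density_ae_eq x y)
  rw [restrict_target_prod]
  exact (hα x).comp_fst.mul (hη y).comp_snd

theorem chartMeasure_prodForm [MeasurableSpace M] [BorelSpace M] [MeasurableSpace N] [BorelSpace N]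
    [SFinite b.addHaar] [SFinite c.addHaar]
    [SecondCountableTopologyEither E F]
    (hα : HasMeasurableDensity I b α) (hη : HasMeasurableDensity J c η) (x : M) (y : N) :
    chartMeasure (I.prod J) (b.prod c) (prodForm I J α η) (x, y) =
      (chartMeasure I b α x).prod (chartMeasure J c η y) := by
  rw [chartMeasure, chartMeasure, chartMeasure, ← withDensity_congr_ae (prodForm_density_ae_eq x y),
    restrict_target_prod, ← prod_withDensity₀ (hα x) (hη y)]
  -- The inverse charts are known only to be a.e. measurable, so the product of the image measures
  -- is formed with measurable representatives.
  have hx := (aemeasurable_extChartAt_symm (I := I) b.addHaar x).mono_ac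
    (withDensity_absolutelyContinuous _ fun u => ENNReal.ofReal |localForm I α x u b|)
  have hy := (aemeasurable_extChartAt_symm (I := J) c.addHaar y).mono_ac
    (withDensity_absolutelyContinuous _ fun u => ENNReal.ofReal |localForm J η y u c|)
  rw [Measure.map_congr hx.ae_eq_mk, Measure.map_congr hy.ae_eq_mk,
    Measure.map_prod_map _ _ hx.measurable_mk hy.measurable_mk]
  refine Measure.map_congr ?_
  rw [extChartAt_prod]
  filter_upwards [Measure.quasiMeasurePreserving_fst.ae hx.ae_eq_mk,
    Measure.quasiMeasurePreserving_snd.ae hy.ae_eq_mk] with z h1 h2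
  exact Prod.ext h1 h2

end ProductMeasure

/-! ### The chart measures of the circle are Haar measure. -/

section CircleMeasure

attribute [local instance] finrank_real_complex_fact'

/-- The model space of the circle. -/
abbrev Line : Type := EuclideanSpace ℝ (Fin 1)

/-- The standard basis of the model space of the circle. -/
noncomputable abbrev lineBasis : Module.Basis (Fin 1) ℝ Line :=
  (EuclideanSpace.basisFun (Fin 1) ℝ).toBasis

theorem circle_chartAt_source (z : Circle) : (chartAt Line z).source = {-z}ᶜ :=
  stereographic'_source (E := ℂ) (n := 1) (-z)

theorem AlternatingMap.apply_comp_basis {V ι : Type*} [AddCommGroup V] [Module ℝ V] [Fintype ι]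
    (b : Module.Basis ι ℝ V) (a : V [⋀^ι]→ₗ[ℝ] ℝ) (L : V →ₗ[ℝ] V) :
    a (L ∘ b) = LinearMap.det L * a b := by
  classical
  rw [a.eq_smul_basis_det b]
  simp only [AlternatingMap.smul_apply, Module.Basis.det_comp, smul_eq_mul]
  ring

/-- The parametrization of the circle by its model space. -/
noncomputable def lineParam (u : Line) : Circle := circleParam (u 0)

/-- The coordinate of the model space of the circle. -/
noncomputable def lineCoord : Line →L[ℝ] ℝ := EuclideanSpace.proj 0

theorem contDiff_line_coord {m : ℕ∞ω} : ContDiff ℝ m (fun u : Line => u 0) :=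
  lineCoord.contDiff

theorem contMDiff_lineParam {m : ℕ∞ω} : ContMDiff 𝓘(ℝ, Line) (𝓡 1) m lineParam :=
  contMDiff_circleParam.comp contDiff_line_coord.contMDiff

theorem mdifferentiable_lineParam : MDifferentiable 𝓘(ℝ, Line) (𝓡 1) lineParam :=
  (contMDiff_lineParam (m := 1)).mdifferentiable one_ne_zero

theorem pullbackForm_lineParam_circleForm (u : Line) :
    pullbackForm 𝓘(ℝ, Line) (𝓡 1) lineParam circleForm u lineBasis = 1 := by
  refine (pullbackForm_circleForm_apply (mdifferentiable_lineParam u) _).trans ?_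
  rw [mfderiv_eq_fderiv]
  have h0 : HasFDerivAt (fun u : Line => u 0)
      lineCoord u := lineCoord.hasFDerivAt
  have h1 : HasDerivAt (fun s : ℝ => (circleParam s : ℂ))
      (circleParam (u 0) * (2 * Real.pi * Complex.I)) (u 0) := by
    simp only [coe_circleParam]
    have := ((hasDerivAt_id (u 0)).ofReal_comp.const_mul (2 * Real.pi * Complex.I)).cexp
    simpa using this
  have h2 := (HasFDerivAt.comp u h1.hasFDerivAt h0).fderiv
  have h3 : (fun q : Line => (lineParam q : ℂ)) =
    (fun s : ℝ => (circleParam s : ℂ)) ∘ fun u : Line => u 0 := rfl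
  rw [h3, h2]
  have h4 : lineBasis 0 0 = 1 := by simp [lineBasis]
  have hz : star (lineParam u : ℂ) * (lineParam u : ℂ) = 1 := by
    simpa [Circle.normSq_coe] using
      (Complex.normSq_eq_conj_mul_self (z := (lineParam u : ℂ))).symm
  change angularForm (lineParam u)
    ((lineBasis 0 0 : ℝ) • ((lineParam u : ℂ) * (2 * Real.pi * Complex.I))) = 1
  rw [h4, one_smul, angularForm, ← mul_assoc, hz, one_mul]
  have := Real.pi_ne_zero
  simp
  field_simp

theorem continuousOn_localForm_circleForm (z : Circle) :
    ContinuousOn (fun u => localForm (𝓡 1) circleForm z u lineBasis)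
      (extChartAt (𝓡 1) z).target := by
  have hopen := isOpen_extChartAt_target (I := 𝓡 1) z
  let g : Line → ℂ := fun u => ((extChartAt (𝓡 1) z).symm u : ℂ)
  have hg : ContDiffOn ℝ 1 g (extChartAt (𝓡 1) z).target :=
    (contMDiff_coe_circle.comp_contMDiffOn (contMDiffOn_extChartAt_symm z)).contDiffOn
  have h1 : ContinuousOn (fun u => angularForm (g u) (fderiv ℝ g u (lineBasis 0)))
      (extChartAt (𝓡 1) z).target := by
    have h2 := (hg.continuousOn_fderiv_of_isOpen hopen le_rfl).clm_apply
      (continuousOn_const (c := lineBasis 0))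
    exact continuousOn_const.mul
      (Complex.continuous_im.comp_continuousOn (hg.continuousOn.star.mul h2))
  refine h1.congr fun u hu => ?_
  dsimp only
  refine (pullbackForm_circleForm_apply (mdifferentiableAt_extChartAt_symm hu) _).trans ?_
  rw [mfderiv_eq_fderiv]
  rfl

theorem hasMeasurableDensity_circleForm :
    HasMeasurableDensity (𝓡 1) lineBasis circleForm := fun z =>
  ((continuousOn_localForm_circleForm z).aemeasurable
    (isOpen_extChartAt_target z).measurableSet).norm.ennreal_ofReal

theorem injOn_circleParam (a : ℝ) : Set.InjOn circleParam (Set.Ioo a (a + 1)) := by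
  intro s hs t ht hst
  obtain ⟨n, hn⟩ := circleParam_eq_iff.1 hst
  have h1 : (n : ℝ) < 1 := by linarith [hs.2, ht.1]
  have h2 : (-1 : ℝ) < n := by linarith [hs.1, ht.2]
  have h3 : n = 0 := by
    have h1' : n < 1 := by exact_mod_cast h1
    have h2' : -1 < n := by exact_mod_cast h2
    omega
  simpa [h3] using hn

theorem image_circleParam (a : ℝ) : circleParam '' Set.Ioo a (a + 1) = {circleParam a}ᶜ := by
  ext z
  constructor
  · rintro ⟨s, hs, rfl⟩ h
    obtain ⟨n, hn⟩ := circleParam_eq_iff.1 h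
    have h1 : (0 : ℝ) < n := by linarith [hs.1]
    have h2 : (n : ℝ) < 1 := by linarith [hs.2]
    have h1' : 0 < n := by exact_mod_cast h1
    have h2' : n < 1 := by exact_mod_cast h2
    omega
  · intro hz
    obtain ⟨s, rfl⟩ : ∃ s, circleParam s = z := ⟨_, circleParam_arg z⟩
    have h1 : circleParam (a + Int.fract (s - a)) = circleParam s := by
      refine circleParam_eq_iff.2 ⟨-⌊s - a⌋, ?_⟩
      rw [Int.fract]
      push_cast
      ring
    refine ⟨a + Int.fract (s - a), ⟨?_, ?_⟩, h1⟩
    · refine lt_add_of_pos_right _ (lt_of_le_of_ne (Int.fract_nonneg _) fun h => hz ?_)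
      rw [← h, add_zero] at h1
      exact h1.symm
    · linarith [Int.fract_lt_one (s - a)]

/-- The chart at z omits only -z, so its domain is parametrized by an open unit interval starting at
a parameter of -z. In this parameter the form is dt, and the change of variables T to the chart
coordinate turns the density into 1. -/
theorem chartMeasure_circleForm_eq_map (z : Circle) : ∃ a : ℝ,
    chartMeasure (𝓡 1) lineBasis circleForm z =
      (volume.restrict ((fun u : Line => u 0) ⁻¹' Set.Ioo a (a + 1))).map lineParam := by
  obtain ⟨a, ha⟩ : ∃ a, circleParam a = -z := ⟨_, circleParam_arg _⟩
  refine ⟨a, ?_⟩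
  set S : Set Line := (fun u : Line => u 0) ⁻¹' Set.Ioo a (a + 1) with hS
  have hcoord : Continuous fun u : Line => u 0 := (contDiff_line_coord (m := 0)).continuous
  have hSo : IsOpen S := isOpen_Ioo.preimage hcoord
  set χ := extChartAt (𝓡 1) z with hχ
  have hsrc : lineParam '' S = χ.source := by
    rw [hχ, extChartAt_source, circle_chartAt_source, ← ha, ← image_circleParam]
    ext w
    constructor
    · rintro ⟨u, hu, rfl⟩
      exact ⟨u 0, hu, rfl⟩
    · rintro ⟨s, hs, rfl⟩
      exact ⟨WithLp.toLp 2 fun _ => s, hs, rfl⟩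
  have hinj : Set.InjOn lineParam S := by
    intro u hu w hw h
    have h0 := injOn_circleParam a hu hw h
    ext i
    rw [Subsingleton.elim i 0]
    exact h0
  let T : Line → Line := χ ∘ lineParam
  have hmem : ∀ u ∈ S, lineParam u ∈ χ.source := fun u hu => hsrc ▸ Set.mem_image_of_mem _ hu
  have hTinj : Set.InjOn T S := χ.injOn.comp hinj hmem
  have hTim : T '' S = χ.target := by
    rw [Set.image_comp, hsrc, χ.image_source_eq_target]
  have hTd : ∀ u ∈ S, MDifferentiableAt 𝓘(ℝ, Line) 𝓘(ℝ, Line) T u := by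
    intro u hu
    have h1 : ContMDiffAt (𝓡 1) 𝓘(ℝ, Line) 1 χ (lineParam u) :=
      contMDiffAt_extChartAt' (by rw [← extChartAt_source (𝓡 1)]; exact hmem u hu)
    exact (h1.mdifferentiableAt one_ne_zero).comp u (mdifferentiable_lineParam u)
  have hTd' : ∀ u ∈ S, HasFDerivWithinAt T (fderiv ℝ T u) S u := fun u hu =>
    (hTd u hu).differentiableAt.hasFDerivAt.hasFDerivWithinAt
  -- Near u the map χ⁻¹ ∘ T is `lineParam`, which pulls the form back to one with value 1 on the
  -- basis.
  have hdet : ∀ u ∈ S, ENNReal.ofReal |(fderiv ℝ T u).det| *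
      ENNReal.ofReal |localForm (𝓡 1) circleForm z (T u) lineBasis| = 1 := by
    intro u hu
    have hsymm : (χ.symm ∘ T) =ᶠ[nhds u] lineParam := by
      filter_upwards [hSo.mem_nhds hu] with w hw using χ.left_inv (hmem w hw)
    have h1 := pullbackForm_comp_apply (I := 𝓘(ℝ, Line)) (J := 𝓘(ℝ, Line)) (I' := 𝓡 1)
      (φ := T) (χ := χ.symm) (p := u)
      (mdifferentiableAt_extChartAt_symm (hTim ▸ Set.mem_image_of_mem _ hu)) (hTd u hu) circleForm
    have h2 : pullbackForm 𝓘(ℝ, Line) (𝓡 1) (χ.symm ∘ T) circleForm u lineBasis = 1 := by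
      rw [← pullbackForm_lineParam_circleForm u]
      have h3 : (χ.symm ∘ T) u = lineParam u := hsymm.self_of_nhds
      simp only [pullbackForm]
      rw [hsymm.mfderiv_eq, h3]
    rw [← h1] at h2
    have h4 : localForm (𝓡 1) circleForm z (T u) (fderiv ℝ T u ∘ lineBasis) = 1 := by
      rw [← h2]
      simp only [pullbackForm]
      rw [mfderiv_eq_fderiv]
      rfl
    have h5 := AlternatingMap.apply_comp_basis lineBasis
      (localForm (𝓡 1) circleForm z (T u)) (fderiv ℝ T u : Line →ₗ[ℝ] Line)
    rw [← ENNReal.ofReal_mul (abs_nonneg _), ← abs_mul]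
    have h6 : (fderiv ℝ T u).det * localForm (𝓡 1) circleForm z (T u) lineBasis = 1 :=
      h5.symm.trans h4
    rw [h6, abs_one, ENNReal.ofReal_one]
  have hTm : AEMeasurable T (volume.restrict S) :=
    ContinuousOn.aemeasurable (fun u hu => (hTd' u hu).continuousWithinAt) hSo.measurableSet
  have hlam : lineBasis.addHaar = volume := OrthonormalBasis.addHaar_eq_volume _
  have hden : (lineBasis.addHaar.restrict χ.target).withDensity
      (fun u => ENNReal.ofReal |localForm (𝓡 1) circleForm z u lineBasis|) =
      (volume.restrict S).map T := by
    rw [hlam]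
    ext A hA
    rw [withDensity_apply _ hA, Measure.map_apply_of_aemeasurable hTm hA, ← lintegral_indicator hA,
      ← hTim, lintegral_image_eq_lintegral_abs_det_fderiv_mul volume hSo.measurableSet hTd' hTinj]
    have h7 : ∀ u ∈ S, ENNReal.ofReal |(fderiv ℝ T u).det| *
        A.indicator (fun u => ENNReal.ofReal |localForm (𝓡 1) circleForm z u lineBasis|) (T u) =
        (T ⁻¹' A).indicator 1 u := by
      intro u hu
      by_cases hA' : T u ∈ A
      · rw [Set.indicator_of_mem hA', hdet u hu, Set.indicator_of_mem (by exact hA')]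
        rfl
      · rw [Set.indicator_of_notMem hA', mul_zero, Set.indicator_of_notMem (by exact hA')]
    rw [setLIntegral_congr_fun hSo.measurableSet h7,
      lintegral_indicator_one₀ (hTm.nullMeasurableSet_preimage hA)]
  have hsm := aemeasurable_extChartAt_symm (I := 𝓡 1) lineBasis.addHaar z
  rw [chartMeasure, hden, AEMeasurable.map_map_of_aemeasurable ?_ hTm]
  · refine Measure.map_congr ?_
    filter_upwards [ae_restrict_mem hSo.measurableSet] with u hu using χ.left_inv (hmem u hu)
  · rw [← hden]
    exact hsm.mono_ac (withDensity_absolutelyContinuous _ _)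

/-- The isomorphism `ℝ / ℤ → S¹`. -/
noncomputable def addCircleParam : AddCircle (1 : ℝ) → Circle := circleParam_periodic.lift

theorem continuous_addCircleParam : Continuous addCircleParam :=
  continuous_quot_lift _ continuous_circleParam

theorem addCircleParam_add (c : ℝ) (x : AddCircle (1 : ℝ)) :
    addCircleParam ((c : AddCircle (1 : ℝ)) + x) = circleParam c * addCircleParam x := by
  induction x using QuotientAddGroup.induction_on with
  | H s => exact circleParam_add c s

/-- The omitted point is null, so the result no longer depends on the chart. -/
theorem chartMeasure_circleForm (z : Circle) :
    chartMeasure (𝓡 1) lineBasis circleForm z =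
      (volume : Measure (AddCircle (1 : ℝ))).map addCircleParam := by
  obtain ⟨a, ha⟩ := chartMeasure_circleForm_eq_map z
  have hcoord : MeasurePreserving (fun u : Line => u 0) volume volume :=
    (volume_preserving_funUnique (Fin 1) ℝ).comp (PiLp.volume_preserving_ofLp (Fin 1))
  have h1 := hcoord.restrict_preimage (measurableSet_Ioo (a := a) (b := a + 1))
  have h2 := AddCircle.measurePreserving_mk 1 a
  rw [ha, show lineParam = circleParam ∘ fun u : Line => u 0 from rfl,
    ← Measure.map_map continuous_circleParam.measurable hcoord.measurable, h1.map_eq,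
    restrict_Ioo_eq_restrict_Ioc, ← h2.map_eq,
    Measure.map_map continuous_addCircleParam.measurable h2.measurable]
  rfl

theorem measurePreserving_mul_left_chartMeasure (w z : Circle) :
    MeasurePreserving (fun y => w * y) (chartMeasure (𝓡 1) lineBasis circleForm z)
      (chartMeasure (𝓡 1) lineBasis circleForm z) := by
  obtain ⟨c, rfl⟩ : ∃ c, circleParam c = w := ⟨_, circleParam_arg w⟩
  refine ⟨(continuous_const_mul (circleParam c)).measurable, ?_⟩
  have h := measurePreserving_add_left (volume : Measure (AddCircle (1 : ℝ))) (c : AddCircle (1 : ℝ))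
  rw [chartMeasure_circleForm, Measure.map_map (continuous_const_mul (circleParam c)).measurable
    continuous_addCircleParam.measurable]
  conv_rhs => rw [← h.map_eq]
  rw [Measure.map_map continuous_addCircleParam.measurable h.measurable]
  congr 1
  funext x
  exact (addCircleParam_add c x).symm

end CircleMeasure

/-! ### Fibre rotations preserve the volume measure. -/

section VolumeMeasure

/-- Pushforward along a homeomorphism is monotone with monotone inverse, so it commutes with suprema
of measures. -/
theorem MeasureTheory.MeasurePreserving.iSup_homeomorph {X ι : Type*} [TopologicalSpace X]
    [MeasurableSpace X] [BorelSpace X] (ψ : X ≃ₜ X) {ρ : ι → Measure X}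
    (h : ∀ i, MeasurePreserving ψ (ρ i) (ρ i)) : MeasurePreserving ψ (⨆ i, ρ i) (⨆ i, ρ i) := by
  have hm : Measurable ψ := ψ.continuous.measurable
  have hm' : Measurable ψ.symm := ψ.symm.continuous.measurable
  refine ⟨hm, le_antisymm ?_ ?_⟩
  · have h1 : ⨆ i, ρ i ≤ (⨆ i, ρ i).map ψ.symm := iSup_le fun i => by
      have h2 : (ρ i).map ψ.symm = ρ i := by
        conv_lhs => rw [← (h i).map_eq]
        rw [Measure.map_map hm' hm, ψ.symm_comp_self, Measure.map_id]
      rw [← h2]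
      exact Measure.map_mono (le_iSup ρ i) hm'
    refine (Measure.map_mono h1 hm).trans ?_
    rw [Measure.map_map hm hm', ψ.self_comp_symm, Measure.map_id]
  · exact iSup_le fun i => (h i).map_eq.symm.le.trans (Measure.map_mono (le_iSup ρ i) hm)

theorem IsVolumeForm.hasMeasurableDensity {E : Type*} [NormedAddCommGroup E] [NormedSpace ℝ E]
    {H : Type*} [TopologicalSpace H] {I : ModelWithCorners ℝ E H} [I.Boundaryless]
    {M : Type*} [TopologicalSpace M] [ChartedSpace H M] {ι : Type*} [Fintype ι]
    [MeasurableSpace E] [BorelSpace E] {α : FormField I M ι} (hα : IsVolumeForm I α)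
    (b : Module.Basis ι ℝ E) : HasMeasurableDensity I b α := fun x =>
  ((hα.smooth x b).continuousOn.aemeasurable
    (isOpen_extChartAt_target x).measurableSet).norm.ennreal_ofReal

/-- Each chart measure is preserved separately, although chart domains are not invariant: its last
factor is Haar measure on the whole circle, so the map is a skew product with measure-preserving
fibres. -/
theorem measurePreserving_fiberRotation {n : ℕ} {M : Type*} [TopologicalSpace M]
    [SecondCountableTopology M] [ChartedSpace (EuclideanSpace ℝ (Fin n)) M] [IsManifold (𝓡 n) 1 M]
    [MeasurableSpace M] [BorelSpace M] {μ : FormField (𝓡 n) M (Fin n)} (hμ : IsVolumeForm (𝓡 n) μ)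
    {g : Circle → ℝ} (hg : Continuous g) :
    MeasurePreserving (fiberRotation M hg)
      (volumeMeasure (bundleModel n) (stdBasis n) (bundleForm μ))
      (volumeMeasure (bundleModel n) (stdBasis n) (bundleForm μ)) := by
  refine MeasurePreserving.iSup_homeomorph _ fun p => ?_
  obtain ⟨m, x, y⟩ := p
  have hT := hasMeasurableDensity_circleForm.prodForm hasMeasurableDensity_circleForm
  have hdec : chartMeasure (bundleModel n) (stdBasis n) (bundleForm μ) (m, x, y) =
      (chartMeasure (𝓡 n) (EuclideanSpace.basisFun (Fin n) ℝ).toBasis μ m).prod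
        ((chartMeasure (𝓡 1) lineBasis circleForm x).prod
          (chartMeasure (𝓡 1) lineBasis circleForm y)) := by
    rw [← chartMeasure_prodForm hasMeasurableDensity_circleForm hasMeasurableDensity_circleForm]
    exact chartMeasure_prodForm (hμ.hasMeasurableDensity _) hT m (x, y)
  rw [hdec]
  have hsf : ∀ z, SFinite (chartMeasure (𝓡 1) lineBasis circleForm z) := fun z => by
    rw [chartMeasure_circleForm]; infer_instance
  have hsm : SFinite (chartMeasure (𝓡 n) (EuclideanSpace.basisFun (Fin n) ℝ).toBasis μ m) := by
    rw [chartMeasure]; infer_instance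
  have hc : Continuous (Function.uncurry fun x y : Circle => circleParam (g x) * y) := by
    have := continuous_circleParam
    simp only [Function.uncurry_def]
    fun_prop
  exact (MeasurePreserving.id _).prod ((MeasurePreserving.id _).skew_product hc.measurable
    (Filter.Eventually.of_forall fun x =>
      (measurePreserving_mul_left_chartMeasure (circleParam (g x)) y).map_eq))

end VolumeMeasure

/-! ### Choice of θ and f, and the main theorem. -/

/-- The rotation number and the function of a Furstenberg map that is topologically, but not
differentiably, conjugate to the one with the function `0`. -/
theorem exists_furstenberg_conjugate_not_contMDiff (n : ℕ) (M : Type*) [TopologicalSpace M]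
    [Nonempty M] [ChartedSpace (EuclideanSpace ℝ (Fin n)) M] :
    ∃ (θ : ℝ) (f g : Circle → ℝ) (hg : Continuous g), Irrational θ ∧
      ContMDiff (𝓡 1) 𝓘(ℝ, ℝ) ∞ f ∧ ∀ d : ℤ, d ≠ 0 →
        ⇑(fiberRotation M hg) ∘ Prod.map id (furstenberg θ d f) =
          Prod.map id (furstenberg θ d 0) ∘ ⇑(fiberRotation M hg) ∧
        ¬ ∃ ψ : M × Torus → M × Torus, ContMDiff (bundleModel n) (bundleModel n) 1 ψ ∧
          ψ ∘ Prod.map id (furstenberg θ d f) = Prod.map id (furstenberg θ d 0) ∘ ψ := by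
  obtain ⟨θ, F, G, hθ, hF, hG, hG1, hFG, hF1, hGeven, hGl⟩ :=
    exists_smooth_coboundary_of_not_lipschitz
  have hFp : Function.Periodic F 1 := fun s => by
    rw [hFG, hFG, add_right_comm, hG1, hG1]
  refine ⟨θ, circleFun F, circleFun G, continuous_circleFun hG1 hG, hθ,
    contMDiff_circleFun hFp hF, fun d hd => ⟨fiberRotation_semiconj M d _ fun x => ?_,
      not_exists_contMDiff_semiconj hθ hd (hF.differentiable (by simp)) hFp hG hG1 hFG hF1
        hGeven hGl⟩⟩
  obtain ⟨s, rfl⟩ : ∃ s, circleParam s = x := ⟨_, circleParam_arg x⟩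
  rw [← circleParam_add, circleFun_circleParam hFp, circleFun_circleParam hG1,
    circleFun_circleParam hG1, hFG]

theorem proposition9p2 (n : ℕ) (M : Type*) [TopologicalSpace M] [T2Space M]
    [SecondCountableTopology M] [Nonempty M]
    [ChartedSpace (EuclideanSpace ℝ (Fin n)) M] [IsManifold (𝓡 n) ∞ M]
    [MeasurableSpace M] [BorelSpace M] :
    (∃ (θ : ℝ) (f : Circle → ℝ), Irrational θ ∧ ContMDiff (𝓡 1) 𝓘(ℝ, ℝ) ∞ f ∧
      ∀ d : ℤ, d ≠ 0 →
        ∃ Φ Φ₀ : Diffeomorph (bundleModel n) (bundleModel n) (M × Torus) (M × Torus) ∞,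
          ⇑Φ = Prod.map id (furstenberg θ d f) ∧
          ⇑Φ₀ = Prod.map id (furstenberg θ d 0) ∧
          (∃ ψ : (M × Torus) ≃ₜ (M × Torus), ⇑ψ ∘ ⇑Φ = ⇑Φ₀ ∘ ⇑ψ) ∧
          ¬ ∃ ψ : M × Torus → M × Torus,
            ContMDiff (bundleModel n) (bundleModel n) 1 ψ ∧ ψ ∘ ⇑Φ = ⇑Φ₀ ∘ ψ) ∧
    (∀ μ : FormField (𝓡 n) M (Fin n), IsVolumeForm (𝓡 n) μ →
      ∃ (θ : ℝ) (f : Circle → ℝ), Irrational θ ∧ ContMDiff (𝓡 1) 𝓘(ℝ, ℝ) ∞ f ∧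
      ∀ d : ℤ, d ≠ 0 →
        ∃ Φ Φ₀ : Diffeomorph (bundleModel n) (bundleModel n) (M × Torus) (M × Torus) ∞,
          ⇑Φ = Prod.map id (furstenberg θ d f) ∧
          ⇑Φ₀ = Prod.map id (furstenberg θ d 0) ∧
          pullbackForm (bundleModel n) (bundleModel n) ⇑Φ (bundleForm μ) = bundleForm μ ∧
          pullbackForm (bundleModel n) (bundleModel n) ⇑Φ₀ (bundleForm μ) = bundleForm μ ∧
          (∃ ψ : (M × Torus) ≃ₜ (M × Torus), ⇑ψ ∘ ⇑Φ = ⇑Φ₀ ∘ ⇑ψ ∧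
            MeasurePreserving ψ
              (volumeMeasure (bundleModel n) (stdBasis n) (bundleForm μ))
              (volumeMeasure (bundleModel n) (stdBasis n) (bundleForm μ))) ∧
          ¬ ∃ ψ : M × Torus → M × Torus,
            ContMDiff (bundleModel n) (bundleModel n) 1 ψ ∧ ψ ∘ ⇑Φ = ⇑Φ₀ ∘ ψ) := by
  obtain ⟨θ, f, g, hg, hθ, hf, h⟩ := exists_furstenberg_conjugate_not_contMDiff n M
  have h0 : ContMDiff (𝓡 1) 𝓘(ℝ, ℝ) ∞ (0 : Circle → ℝ) := contMDiff_const
  refine ⟨⟨θ, f, hθ, hf, fun d hd => ⟨furstenbergDiffeo M θ d hf, furstenbergDiffeo M θ d h0,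
    rfl, rfl, ⟨fiberRotation M hg, (h d hd).1⟩, (h d hd).2⟩⟩, fun μ hμ => ⟨θ, f, hθ, hf,
    fun d hd => ⟨furstenbergDiffeo M θ d hf, furstenbergDiffeo M θ d h0, rfl, rfl,
      pullbackForm_furstenberg_bundleForm μ θ d hf, pullbackForm_furstenberg_bundleForm μ θ d h0,
      ⟨fiberRotation M hg, (h d hd).1, measurePreserving_fiberRotation hμ hg⟩, (h d hd).2⟩⟩⟩
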